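/- **Theorem (Fisher–Neyman decomposition for general $\mathrm{VARMA}(p,q)$).** Let $\xi=(\Phi_1,\dots,\Phi_p,\Theta_1,\dots,\Theta_q,\Sigma_\epsilon)$ with $\Phi_i,\Theta_i\in\mathbb R^{n\times n}$ and $\Sigma_\epsilon$ symmetric positive definite. Let $\{Y_t\}_{t\in\mathbb Z}$ be a zero-mean Gaussian $\mathrm{VARMA}(p,q)$ process in $\mathbb R^n$, that is, a zero-mean, square-integrable, weakly stationary process with $$Y_t-\sum_{i=1}^p\Phi_iY_{t-i}=\epsilon_t+\sum_{i=1}^q\Theta_i\epsilon_{t-i}\quad\text{a.s. for every }t\in\mathbb Z,\qquad \epsilon_t\ \text{i.i.d. } \mathcal N(0,\Sigma_\epsilon).$$ Put $\Phi(z)=I_n-\sum_{i=1}^p\Phi_iz^i$, $\Theta(z)=I_n+\sum_{i=1}^q\Theta_iz^i$, and assume * (causality and invertibility) $\det\Phi(z)\ne0$ and $\det\Theta(z)\neq0$ for all $z\in\mathbb C$ with $|z|\le1$; * (symmetric covariance) for all $z\in\mathbb C$ with $|z|=1$, $$\Phi(z)^{-1}\Theta(z)\Sigma_\epsilon\Theta(z^{-1})^\top\Phi(z^{-1})^{\top-1}=\Phi(z^{-1})^{-1}\Theta(z^{-1})\Sigma_\epsilon\Theta(z)^\top\Phi(z)^{\top-1}.$$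 Let $T\ge0$, $Y=(Y_1,\dots,Y_T)$, $l=\max\{p,q\}$, and define, for $1\le t\le T$, the forward transformation $$W_t=Y_t-\sum_{i=1}^p\Phi_iY_{t+i}\ \ (t\le T-l),\qquad W_t=Y_t\ \ (t>T-l).$$ Let $\Theta_0=I_n$, $\Theta_i=0$ for $i>q$, let $\Psi_j$ be the coefficients of $\Phi(z)^{-1}\Theta(z)=\sum_{j\ge0}\Psi_jz^j$, let $\Gamma_Y(h)=\sum_{j\ge0}\Psi_{j+h}\Sigma_\epsilon\Psi_j^\top$ and $\Gamma_Y(-h)=\Gamma_Y(h)^\top$ for $h\ge0$, and, for $1\le s\le t\le T$ and $h=t-s$, let $$\Gamma_W(t,s)=\begin{cases}\Gamma_Y(h),& T-l<s\le t\le T,\\ \Gamma_Y(h)-\sum_{i=1}^p\Gamma_Y(h-i)\Phi_i^\top,& T-2l<s\le T-l<t\le T,\\ \sum_{i=0}^{q-h}\Theta_i\Sigma_\epsilon\Theta_{i+h}^\top,& t\le T-l,\ h\le q,\\ 0,&\text{otherwise.}\end{cases}$$ Define recursively (innovations algorithm), for $1\le t\le T$, $$\Sigma_t=\Gamma_W(t,t)-\sum_{j=1}^{t-1}\Theta_{t-1,j}\Sigma_{t-j}\Theta_{t-1,j}^\top,\qquad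 \hat W_t=\sum_{j=1}^{t-1}\Theta_{t-1,j}(W_{t-j}-\hat W_{t-j}),$$ and, for $1\le j\le t\le T-1$, $$\Theta_{t,j}=\Bigl(\Gamma_W(t+1,t-j+1)-\sum_{k=0}^{t-j-1}\Theta_{t,t-k}\Sigma_{k+1}\Theta_{t-j,t-j-k}^\top\Bigr)\Sigma_{t-j+1}^{-1}.$$ Then: 1. the law of $Y$ has a density (likelihood) with respect to Lebesgue measure on $(\mathbb R^n)^T$, and it is $L(Y;\xi)=g_0(Y)\,g_1(Y,\xi)$, where $g_0(Y)=(2\pi)^{-nT/2}$ and $$g_1(Y,\xi)=\Bigl(\prod_{t=1}^T\det\Sigma_t\Bigr)^{-1/2}\exp\Bigl\{-\tfrac12\sum_{t=1}^T(W_t-\hat W_t)^\top\Sigma_t^{-1}(W_t-\hat W_t)\Bigr\};$$ 2. $\operatorname{Cov}(Y_t,Y_{t-h})=\Gamma_Y(h)$ for all $t,h\in\mathbb Z$, and $\operatorname{Cov}(W_t,W_s)=\Gamma_W(t,s)$ for $1\le s\le t\le T$; 3. for $1\le t\le T$, $\hat W_t=\mathbb E[W_t\mid W_1,\dots,W_{t-1}]$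 a.s., and the prediction error $W_t-\hat W_t$ has covariance matrix $\Sigma_t$, which is positive definite. -/

import Mathlib

open MeasureTheory ProbabilityTheory
open scoped Matrix

/-- Parameters `ξ = (Φ₁, …, Φ_p, Θ₁, …, Θ_q, Σ_ε)` of an `n`-dimensional `VARMA(p, q)` model.
`Φ i` and `Θ i` are the coefficients of lag `i + 1`. -/
structure VARMAParam (n p q : ℕ) where
  Φ : Fin p → Matrix (Fin n) (Fin n) ℝ
  Θ : Fin q → Matrix (Fin n) (Fin n) ℝ
  covEps : Matrix (Fin n) (Fin n) ℝ

noncomputable section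

namespace VARMAParam

variable {n p q : ℕ} (ξ : VARMAParam n p q)

/-- The autoregressive matrix polynomial `Φ(z) = I - ∑ Φ_i z^i`. -/
def arPoly (z : ℂ) : Matrix (Fin n) (Fin n) ℂ :=
  1 - ∑ i : Fin p, z ^ ((i : ℕ) + 1) • (ξ.Φ i).map Complex.ofReal

/-- The moving average matrix polynomial `Θ(z) = I + ∑ Θ_i z^i`. -/
def maPoly (z : ℂ) : Matrix (Fin n) (Fin n) ℂ :=
  1 + ∑ i : Fin q, z ^ ((i : ℕ) + 1) • (ξ.Θ i).map Complex.ofReal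

/-- Causality and invertibility. -/
def CausalInvertible : Prop :=
  ∀ z : ℂ, ‖z‖ ≤ 1 → (ξ.arPoly z).det ≠ 0 ∧ (ξ.maPoly z).det ≠ 0

/-- The matrix `Φ(z)⁻¹ Θ(z) Σ_ε Θᵀ(w) (Φᵀ(w))⁻¹`. -/
def spectral (z w : ℂ) : Matrix (Fin n) (Fin n) ℂ :=
  (ξ.arPoly z)⁻¹ * ξ.maPoly z * ξ.covEps.map Complex.ofReal * (ξ.maPoly w)ᵀ *
    ((ξ.arPoly w)ᵀ)⁻¹

/-- Symmetric covariance. -/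
def SymmetricCovariance : Prop :=
  ∀ z : ℂ, ‖z‖ = 1 → ξ.spectral z z⁻¹ = ξ.spectral z⁻¹ z

/-- `Y` is a zero-mean Gaussian `VARMA(p, q)` process with parameters `ξ`: a zero-mean weakly
stationary solution of the `VARMA` equation driven by i.i.d. `N(0, Σ_ε)` noise. -/
def IsVARMA {Ω : Type*} [MeasurableSpace Ω] (P : Measure Ω) (Y : ℤ → Ω → Fin n → ℝ) : Prop :=
  (∀ t, Measurable (Y t)) ∧
  (∀ t i, MemLp (fun ω => Y t ω i) 2 P) ∧
  (∀ t i, ∫ ω, Y t ω i ∂P = 0) ∧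
  (∀ s t i j, cov[fun ω => Y (t + s) ω i, fun ω => Y t ω j; P] =
    cov[fun ω => Y s ω i, fun ω => Y 0 ω j; P]) ∧
  ∃ ε : ℤ → Ω → Fin n → ℝ,
    (∀ t, Measurable (ε t)) ∧
    iIndepFun ε P ∧
    (∀ t, P.map (fun ω => WithLp.toLp 2 (ε t ω)) = multivariateGaussian 0 ξ.covEps) ∧
    ∀ t, ∀ᵐ ω ∂P,
      Y t ω - ∑ i : Fin p, ξ.Φ i *ᵥ Y (t - ((i : ℤ) + 1)) ω =
        ε t ω + ∑ i : Fin q, ξ.Θ i *ᵥ ε (t - ((i : ℤ) + 1)) ω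

/-- `Θ₀ = I`, then `Θ₁, …, Θ_q`, then `0`. -/
def ma : ℕ → Matrix (Fin n) (Fin n) ℝ
  | 0 => 1
  | i + 1 => if h : i < q then ξ.Θ ⟨i, h⟩ else 0

/-- Coefficients `Ψ_j` of the causal representation `Y_t = ∑ Ψ_j ε_{t-j}`, that is, of the
power series `Φ(z)⁻¹ Θ(z)`. -/
def psi : ℕ → Matrix (Fin n) (Fin n) ℝ
  | j => ξ.ma j + ∑ i : Fin p,
      if _h : (i : ℕ) + 1 ≤ j then ξ.Φ i * psi (j - ((i : ℕ) + 1)) else 0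
decreasing_by omega

/-- The autocovariance `Γ_Y(h) = ∑_j Ψ_{j+h} Σ_ε Ψ_jᵀ` for `h ≥ 0`, and `Γ_Y(-h) = Γ_Y(h)ᵀ`. -/
def gammaY (h : ℤ) : Matrix (Fin n) (Fin n) ℝ :=
  ∑' j : ℕ, ξ.psi (j + h.toNat) * ξ.covEps * (ξ.psi (j + (-h).toNat))ᵀ

/-- The covariance `Γ_W(t, s)`, for times `1 ≤ s ≤ t ≤ T`, of the forward-transformed
process, with `l = max p q` and lag `h = t - s`. -/
def gammaW (T t s : ℕ) : Matrix (Fin n) (Fin n) ℝ :=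
  let l := max p q
  let h := t - s
  if T < t + l then
    if T < s + l then ξ.gammaY h
    else if T < s + 2 * l then
      ξ.gammaY h - ∑ i : Fin p, ξ.gammaY ((h : ℤ) - ((i : ℤ) + 1)) * (ξ.Φ i)ᵀ
    else 0
  else if h ≤ q then
    ∑ i ∈ Finset.range (q - h + 1), ξ.ma i * ξ.covEps * (ξ.ma (i + h))ᵀ
  else 0

end VARMAParam

/-- The observation `Y_t`, `1 ≤ t ≤ T`, in a sample of length `T` (and `0` at other times). -/
def obsAt {n T : ℕ} (y : Fin T → Fin n → ℝ) (t : ℕ) : Fin n → ℝ :=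
  if h : 1 ≤ t ∧ t ≤ T then y ⟨t - 1, by omega⟩ else 0

/-- The sample `(Y_1, …, Y_T)` of a process. -/
def sampleOf {Ω : Type*} {n : ℕ} (T : ℕ) (Y : ℤ → Ω → Fin n → ℝ) (ω : Ω) :
    Fin T → Fin n → ℝ :=
  fun k => Y ((k : ℤ) + 1) ω

section Innovations

/- The innovations algorithm for a process `W_1, W_2, …` with covariances `K t s = Cov(W_t, W_s)`,
`s ≤ t`: the coefficients `Θ_{t,j}` (`1 ≤ j ≤ t`) and the error covariances `Σ_t` (`1 ≤ t`). -/
mutual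

def innovCoef {n : ℕ} (K : ℕ → ℕ → Matrix (Fin n) (Fin n) ℝ) (t j : ℕ) :
    Matrix (Fin n) (Fin n) ℝ :=
  if _h : 1 ≤ j ∧ j ≤ t then
    (K (t + 1) (t - j + 1) -
      ∑ k : Fin (t - j), innovCoef K t (t - (k : ℕ)) * innovCov K ((k : ℕ) + 1) *
        (innovCoef K (t - j) (t - j - (k : ℕ)))ᵀ) * (innovCov K (t - j + 1))⁻¹
  else 0
termination_by (t, 1 + (t - j))
decreasing_by all_goals omega

def innovCov {n : ℕ} (K : ℕ → ℕ → Matrix (Fin n) (Fin n) ℝ) (t : ℕ) :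
    Matrix (Fin n) (Fin n) ℝ :=
  K t t - ∑ j : Fin (t - 1), innovCoef K (t - 1) ((j : ℕ) + 1) * innovCov K (t - ((j : ℕ) + 1)) *
    (innovCoef K (t - 1) ((j : ℕ) + 1))ᵀ
termination_by (t, 0)
decreasing_by all_goals omega

end

end Innovations

namespace VARMAParam

variable {n p q T : ℕ} (ξ : VARMAParam n p q)

/-- The forward transformation `W_t` of the sample, `1 ≤ t ≤ T`. -/
def forwardW (y : Fin T → Fin n → ℝ) (t : ℕ) : Fin n → ℝ :=
  if t + max p q ≤ T then
    obsAt y t - ∑ i : Fin p, ξ.Φ i *ᵥ obsAt y (t + ((i : ℕ) + 1))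
  else obsAt y t

/-- The coefficients `Θ_{t,j}` of the innovations algorithm of `{W_t}`. -/
def coefW (T t j : ℕ) : Matrix (Fin n) (Fin n) ℝ := innovCoef (ξ.gammaW T) t j

/-- The prediction error covariances `Σ_t` of the innovations algorithm of `{W_t}`. -/
def sigmaW (T t : ℕ) : Matrix (Fin n) (Fin n) ℝ := innovCov (ξ.gammaW T) t

/-- The one-step predictors `Ŵ_t = ∑_{j=1}^{t-1} Θ_{t-1,j} (W_{t-j} - Ŵ_{t-j})`. -/
def predW (y : Fin T → Fin n → ℝ) (t : ℕ) : Fin n → ℝ :=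
  ∑ j : Fin (t - 1), ξ.coefW T (t - 1) ((j : ℕ) + 1) *ᵥ
    (ξ.forwardW y (t - ((j : ℕ) + 1)) - predW y (t - ((j : ℕ) + 1)))
termination_by t
decreasing_by omega

/-- The innovations `W_t - Ŵ_t`. -/
def innovW (y : Fin T → Fin n → ℝ) (t : ℕ) : Fin n → ℝ :=
  ξ.forwardW y t - ξ.predW y t

/-- `h(Y, ξ) = ∑_t (W_t - Ŵ_t)ᵀ Σ_t⁻¹ (W_t - Ŵ_t)`. -/
def quadForm (y : Fin T → Fin n → ℝ) : ℝ :=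
  ∑ t ∈ Finset.Icc 1 T, ξ.innovW y t ⬝ᵥ ((ξ.sigmaW T t)⁻¹ *ᵥ ξ.innovW y t)

/-- The factor `g₁(Y, ξ)`. -/
def gOne (y : Fin T → Fin n → ℝ) : ℝ :=
  (∏ t ∈ Finset.Icc 1 T, (ξ.sigmaW T t).det) ^ (-(1 / 2) : ℝ) * Real.exp (-(ξ.quadForm y) / 2)

end VARMAParam

/-- The factor `g₀(Y) = (2π)^{-nT/2}`. -/
def gZero {n T : ℕ} (_y : Fin T → Fin n → ℝ) : ℝ :=
  (2 * Real.pi) ^ (-((n : ℝ) * (T : ℝ)) / 2)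

end

noncomputable section

-- The proof is second-order geometry in `Lp ℝ 2 P` together with one closedness property of
-- Gaussian variables. Causality makes Φ(z)⁻¹Θ(z) an absolutely convergent power series on the
-- closed disc (`hasSum_psi`) and forces bounded solutions of the homogeneous equation to vanish
-- (`eq_zero_of_homogeneous`). Hence Y_t = ∑ Ψ_j ε_{t-j} in L² (`hasSum_psi_smul`). This identifies
-- Γ_Y and places every linear functional of the sample in the closed span of the noise, all of
-- whose elements are centered Gaussian (`topologicalClosure_span_noiseClass_subset`).
--
-- The symmetry hypothesis says that the spectral density is invariant under z ↦ z⁻¹. Comparing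
-- Fourier coefficients gives Γ_Y(-h) = Γ_Y(h) (`gammaY_neg`), so second moments are unchanged by
-- time reversal. The forward transformation therefore has the covariances of the backward one at
-- reversed times, and the backward one is a moving average of order q. This is where Γ_W comes from
-- (`gram_transformed`).
--
-- The innovations algorithm is block Gram–Schmidt (`gram_innovSeq`). The passage from the sample to
-- W and then to the innovations is unitriangular at each step, in opposite orders of time, so it
-- has determinant 1 (`det_innovMap`). Together with the linear independence of the observations
-- (`eq_zero_of_sum_smul_eq_zero`) this makes every Σ_t positive definite. Multiplying the
-- innovations by R_t with R_tᵀR_t = Σ_t⁻¹ yields a standard Gaussian vector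
-- (`map_eq_pi_gaussianReal`), and a linear change of variables gives the density, its Jacobian
-- being the determinant factor of g₁. Finally, an innovation is uncorrelated with the earlier W_s,
-- hence independent of them, so Ŵ_t is the conditional expectation (`condExp_forwardW`).

-- Fourier coefficients and power series on the unit circle.

theorem integral_exp_I_zpow (k : ℤ) :
    ∫ θ in (0 : ℝ)..2 * Real.pi, Complex.exp (θ * Complex.I) ^ k =
      if k = 0 then 2 * (Real.pi : ℂ) else 0 := by
  split_ifs with hk
  · simp [hk]
  · have hc : (k : ℂ) * Complex.I ≠ 0 := by simp [hk]
    have h1 : ∀ θ : ℝ, Complex.exp (θ * Complex.I) ^ k = Complex.exp ((k * Complex.I) * θ) := by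
      intro θ
      rw [← Complex.exp_int_mul]
      ring_nf
    simp_rw [h1]
    rw [integral_exp_mul_complex hc]
    have h2 : Complex.exp ((k : ℂ) * Complex.I * ((2 * Real.pi : ℝ) : ℂ)) = 1 := by
      rw [Complex.exp_eq_one_iff]
      exact ⟨k, by push_cast; ring⟩
    rw [h2]
    simp

/-- Fourier coefficients of an absolutely convergent Laurent series on the unit circle. -/
theorem hasSum_fourier {α : Type*} [Countable α] {a : α → ℂ} (ha : Summable fun x => ‖a x‖)
    (e : α → ℤ) {G : ℂ → ℂ} (hG : ∀ z : ℂ, ‖z‖ = 1 → HasSum (fun x => a x * z ^ e x) (G z))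
    (h : ℤ) :
    HasSum (fun x => if e x = h then a x else 0)
      ((2 * (Real.pi : ℂ))⁻¹ * ∫ θ in (0 : ℝ)..2 * Real.pi,
        G (Complex.exp (θ * Complex.I)) * Complex.exp (θ * Complex.I) ^ (-h)) := by
  have hpi : (2 * (Real.pi : ℂ)) ≠ 0 := by simp [Real.pi_ne_zero]
  have hn : ∀ θ : ℝ, ‖Complex.exp (θ * Complex.I)‖ = 1 := Complex.norm_exp_ofReal_mul_I
  have h0 : ∀ θ : ℝ, Complex.exp (θ * Complex.I) ≠ 0 := fun θ => Complex.exp_ne_zero _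
  -- The terms have constant modulus `‖a x‖` on the circle, so this summable family dominates and
  -- the series may be integrated term by term.
  have key := intervalIntegral.hasSum_integral_of_dominated_convergence (μ := volume)
    (a := (0 : ℝ)) (b := 2 * Real.pi)
    (F := fun x (θ : ℝ) => a x * Complex.exp (θ * Complex.I) ^ (e x - h))
    (f := fun θ : ℝ => G (Complex.exp (θ * Complex.I)) * Complex.exp (θ * Complex.I) ^ (-h))
    (fun x _ => ‖a x‖)
    (fun x => by
      have : Continuous fun θ : ℝ => a x * Complex.exp (θ * Complex.I) ^ (e x - h) :=
        continuous_const.mul (Continuous.zpow₀ (by fun_prop) _ fun θ => Or.inl (h0 θ))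
      exact this.aestronglyMeasurable)
    (fun x => Filter.Eventually.of_forall fun θ _ => by simp [hn])
    (Filter.Eventually.of_forall fun θ _ => ha)
    (by simp)
    (Filter.Eventually.of_forall fun θ _ => by
      convert! (hG _ (hn θ)).mul_right (Complex.exp (θ * Complex.I) ^ (-h)) using 2 with x
      rw [mul_assoc, ← zpow_add₀ (h0 θ), sub_eq_add_neg])
  convert! key.mul_left ((2 * (Real.pi : ℂ))⁻¹) using 2 with x
  rw [intervalIntegral.integral_const_mul, integral_exp_I_zpow]
  by_cases hx : e x = h
  · rw [if_pos hx, if_pos (by omega)]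
    field_simp
  · rw [if_neg hx, if_neg (by omega)]
    simp

/-- The coefficients of an absolutely convergent power series are determined by its values on the
unit circle. -/
theorem eq_of_hasSum_unitCircle {a b : ℕ → ℂ} {G : ℂ → ℂ}
    (hGa : ∀ z : ℂ, ‖z‖ = 1 → HasSum (fun x => a x * z ^ x) (G z))
    (hGb : ∀ z : ℂ, ‖z‖ = 1 → HasSum (fun x => b x * z ^ x) (G z)) : a = b := by
  have ha : Summable fun x => ‖a x‖ :=
    summable_norm_iff.2 (by simpa using (hGa 1 (by simp)).summable)
  have hb : Summable fun x => ‖b x‖ :=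
    summable_norm_iff.2 (by simpa using (hGb 1 (by simp)).summable)
  funext h
  have ka := hasSum_fourier ha (fun x => (x : ℤ)) (G := G) (by simpa using hGa) h
  have kb := hasSum_fourier hb (fun x => (x : ℤ)) (G := G) (by simpa using hGb) h
  have e1 : ∀ c : ℕ → ℂ, HasSum (fun x : ℕ => if (x : ℤ) = h then c x else 0) (c h) := by
    intro c
    convert! hasSum_ite_eq h (c h) using 2 with x
    by_cases hx : x = h
    · simp [hx]
    · simp [hx]
  exact ((e1 a).unique ka).trans ((e1 b).unique kb).symm

/-- Delaying a series by `i` corresponds to multiplication by z^i; it aligns the lagged series so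
that recursions can be compared term by term. -/
theorem HasSum.shift {M : Type*} [AddCommMonoid M] [TopologicalSpace M] {f : ℕ → M} {s : M}
    (hf : HasSum f s) (i : ℕ) : HasSum (fun m => if i ≤ m then f (m - i) else 0) s := by
  have hinj : Function.Injective (fun k : ℕ => k + i) := add_left_injective i
  rw [← hinj.hasSum_iff]
  · have : (fun m => if i ≤ m then f (m - i) else 0) ∘ (fun k : ℕ => k + i) = f := by
      funext k
      simp
    rwa [this]
  · intro m hm
    rw [if_neg]
    intro him
    exact hm ⟨m - i, by simp [him]⟩

/-- A function holomorphic around the closed unit disc is an absolutely convergent power series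
there. -/
theorem exists_hasSum_of_differentiableOn {g : ℂ → ℂ} {U : Set ℂ} (hU : IsOpen U)
    (hUd : Metric.closedBall 0 1 ⊆ U) (hg : DifferentiableOn ℂ g U) :
    ∃ c : ℕ → ℂ, (Summable fun j => ‖c j‖) ∧
      ∀ z : ℂ, ‖z‖ ≤ 1 → HasSum (fun j => c j * z ^ j) (g z) := by
  -- Compactness leaves room for a disc of radius 1 + δ, so the Cauchy power series converges
  -- absolutely at radius 1, boundary included.
  obtain ⟨δ, hδ, hsub⟩ :=
    (isCompact_closedBall (0 : ℂ) 1).exists_cthickening_subset_open hU hUd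
  rw [cthickening_closedBall hδ.le zero_le_one] at hsub
  obtain ⟨R, hR⟩ : ∃ R : NNReal, (R : ℝ) = δ + 1 := ⟨⟨δ + 1, by positivity⟩, rfl⟩
  rw [← hR] at hsub
  have hR0 : 0 < R := by
    rw [← NNReal.coe_pos, hR]; positivity
  have hp := (hg.mono hsub).hasFPowerSeriesOnBall hR0
  set s := cauchyPowerSeries g 0 R
  have h1R : (1 : NNReal) < R := by
    rw [← NNReal.coe_lt_coe, hR]; simpa using hδ
  refine ⟨fun j => s.coeff j, ?_, fun z hz => ?_⟩
  · have := s.summable_norm_mul_pow (r := 1) ((ENNReal.coe_lt_coe.2 h1R).trans_le hp.r_le)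
    simpa using this
  · have hz' : z ∈ Metric.eball (0 : ℂ) R := by
      rw [Metric.mem_eball, edist_zero_right, enorm_eq_nnnorm, ENNReal.coe_lt_coe]
      exact lt_of_le_of_lt (by exact_mod_cast hz) h1R
    have := hp.hasSum hz'
    simp only [zero_add] at this
    convert! this using 2 with j
    rw [FormalMultilinearSeries.apply_eq_pow_smul_coeff, smul_eq_mul, mul_comm]

theorem Differentiable.matrix_det {m : Type*} [Fintype m] [DecidableEq m]
    {M : ℂ → Matrix m m ℂ} (hM : ∀ a b, Differentiable ℂ fun z => M z a b) :
    Differentiable ℂ fun z => (M z).det := by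
  simp only [Matrix.det_apply]
  fun_prop

theorem Differentiable.matrix_adjugate_apply {m : Type*} [Fintype m] [DecidableEq m]
    {M : ℂ → Matrix m m ℂ} (hM : ∀ a b, Differentiable ℂ fun z => M z a b) (a b : m) :
    Differentiable ℂ fun z => (M z).adjugate a b := by
  simp only [Matrix.adjugate_apply]
  refine Differentiable.matrix_det fun c d => ?_
  by_cases h : c = b
  · subst h
    simp
  · simpa [Matrix.updateRow_ne h] using hM c d

-- The power series of Φ(z)⁻¹Θ(z).

namespace VARMAParam

variable {n p q : ℕ} (ξ : VARMAParam n p q)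

theorem differentiable_arPoly_apply (a b : Fin n) : Differentiable ℂ fun z => ξ.arPoly z a b := by
  simp only [arPoly, Matrix.sub_apply, Matrix.sum_apply, Matrix.smul_apply, smul_eq_mul]
  fun_prop

theorem differentiable_maPoly_apply (a b : Fin n) : Differentiable ℂ fun z => ξ.maPoly z a b := by
  simp only [maPoly, Matrix.add_apply, Matrix.sum_apply, Matrix.smul_apply, smul_eq_mul]
  fun_prop

theorem ma_zero : ξ.ma 0 = 1 := rfl

theorem ma_of_lt {k : ℕ} (hk : q < k) : ξ.ma k = 0 := by
  cases k with
  | zero => omega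
  | succ k => rw [ma, dif_neg (by omega)]

theorem sum_range_ma {M : Type*} [AddCommMonoid M] (f : Matrix (Fin n) (Fin n) ℝ → ℕ → M) :
    ∑ k ∈ Finset.range (q + 1), f (ξ.ma k) k =
      f 1 0 + ∑ i : Fin q, f (ξ.Θ i) ((i : ℕ) + 1) := by
  rw [Finset.sum_range_succ', add_comm, ma_zero, Finset.sum_range]
  congr 1
  refine Finset.sum_congr rfl fun i _ => ?_
  rw [ma, dif_pos i.2]

theorem hasSum_maPoly (z : ℂ) (a b : Fin n) :
    HasSum (fun k => (ξ.ma k a b : ℂ) * z ^ k) (ξ.maPoly z a b) := by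
  have h1 : ξ.maPoly z a b = ∑ k ∈ Finset.range (q + 1), (ξ.ma k a b : ℂ) * z ^ k := by
    rw [ξ.sum_range_ma (fun A k => (A a b : ℂ) * z ^ k)]
    simp only [maPoly, Matrix.add_apply, Matrix.sum_apply, Matrix.smul_apply, smul_eq_mul,
      Matrix.map_apply, pow_zero, mul_one, Complex.ofReal]
    congr 1
    · by_cases hab : a = b
      · subst hab; simp; rfl
      · simp [Matrix.one_apply_ne hab]; rfl
    · exact Finset.sum_congr rfl fun i _ => mul_comm _ _
  rw [h1]
  refine hasSum_sum_of_ne_finset_zero fun k hk => ?_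
  rw [ξ.ma_of_lt (by simpa using hk)]
  simp

theorem psi_eq (j : ℕ) : ξ.psi j = ξ.ma j + ∑ i : Fin p,
    if (i : ℕ) + 1 ≤ j then ξ.Φ i * ξ.psi (j - ((i : ℕ) + 1)) else 0 := by
  rw [psi]
  simp

theorem psi_zero : ξ.psi 0 = 1 := by
  rw [psi_eq]
  simp [ma_zero]

/-- The recursion determines its solution. `D` is complex because it will be the sequence of Taylor
coefficients, which are not known in advance to be real. -/
theorem eq_psi_of_recursion {D : ℕ → Matrix (Fin n) (Fin n) ℂ}
    (hD : ∀ j, D j - ∑ i : Fin p, (if (i : ℕ) + 1 ≤ j then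
      (ξ.Φ i).map Complex.ofReal * D (j - ((i : ℕ) + 1)) else 0) = (ξ.ma j).map Complex.ofReal)
    (j : ℕ) : D j = (ξ.psi j).map Complex.ofReal := by
  induction j using Nat.strong_induction_on with
  | _ j ih =>
    rw [sub_eq_iff_eq_add.1 (hD j), psi_eq]
    have hmap : ∀ A B : Matrix (Fin n) (Fin n) ℝ,
        (A + B).map Complex.ofReal = A.map Complex.ofReal + B.map Complex.ofReal :=
      fun A B => (Complex.ofRealHom.mapMatrix (m := Fin n)).map_add A B
    rw [hmap]
    congr 1
    have hsum := map_sum (Complex.ofRealHom.mapMatrix (m := Fin n)) (fun i : Fin p =>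
      if (i : ℕ) + 1 ≤ j then ξ.Φ i * ξ.psi (j - ((i : ℕ) + 1)) else 0) Finset.univ
    refine Eq.trans ?_ hsum.symm
    refine Finset.sum_congr rfl fun i _ => ?_
    split_ifs with h
    · rw [ih _ (by omega)]
      exact ((Complex.ofRealHom.mapMatrix (m := Fin n)).map_mul _ _).symm
    · simp

/-- `Φ(z)⁻¹ Θ(z) = ∑ Ψ_j z^j` on the closed unit disc. -/
theorem hasSum_psi (hAR : ∀ z : ℂ, ‖z‖ ≤ 1 → (ξ.arPoly z).det ≠ 0) {z : ℂ} (hz : ‖z‖ ≤ 1)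
    (a b : Fin n) :
    HasSum (fun j => (ξ.psi j a b : ℂ) * z ^ j) (((ξ.arPoly z)⁻¹ * ξ.maPoly z) a b) := by
  have hdet : Differentiable ℂ fun z => (ξ.arPoly z).det :=
    .matrix_det ξ.differentiable_arPoly_apply
  have hU : IsOpen {z : ℂ | (ξ.arPoly z).det ≠ 0} :=
    isOpen_ne_fun hdet.continuous continuous_const
  have hg : ∀ a b, DifferentiableOn ℂ (fun z => ((ξ.arPoly z)⁻¹ * ξ.maPoly z) a b)
      {z : ℂ | (ξ.arPoly z).det ≠ 0} := by
    intro a b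
    simp only [Matrix.mul_apply, Matrix.inv_def, Matrix.smul_apply, smul_eq_mul,
      Ring.inverse_eq_inv']
    refine DifferentiableOn.fun_sum fun c _ => ?_
    exact ((hdet.differentiableOn.inv fun z hz => hz).mul
      (Differentiable.matrix_adjugate_apply ξ.differentiable_arPoly_apply a c).differentiableOn).mul
      (ξ.differentiable_maPoly_apply c b).differentiableOn
  choose c hc hcs using fun a b => exists_hasSum_of_differentiableOn hU
    (fun z hz => hAR z (by simpa using hz)) (hg a b)
  -- With F = Φ⁻¹Θ, the identity Φ(z)F(z) = Θ(z) on the circle becomes the recursion for the Taylor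
  -- coefficients of F, by uniqueness of coefficients.
  have hrec : ∀ a b, (fun j => c a b j - ∑ i : Fin p, ∑ d, if (i : ℕ) + 1 ≤ j then
      (ξ.Φ i a d : ℂ) * c d b (j - ((i : ℕ) + 1)) else 0) = fun j => (ξ.ma j a b : ℂ) := by
    intro a b
    refine eq_of_hasSum_unitCircle (G := fun z => ξ.maPoly z a b) (fun z hz => ?_)
      fun z _ => ξ.hasSum_maPoly z a b
    have e1 : ξ.maPoly z a b = ((ξ.arPoly z)⁻¹ * ξ.maPoly z) a b -
        ∑ i : Fin p, ∑ d, ((ξ.Φ i a d : ℂ) * z ^ ((i : ℕ) + 1)) *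
          ((ξ.arPoly z)⁻¹ * ξ.maPoly z) d b := by
      have hu : IsUnit (ξ.arPoly z).det := (hAR z hz.le).isUnit
      conv_lhs => rw [← Matrix.mul_nonsing_inv_cancel_left _ (ξ.maPoly z) hu]
      generalize (ξ.arPoly z)⁻¹ * ξ.maPoly z = F
      rw [arPoly, Matrix.sub_mul, Matrix.one_mul, Matrix.sub_apply, Matrix.sum_mul,
        Matrix.sum_apply]
      congr 1
      refine Finset.sum_congr rfl fun i _ => ?_
      rw [Matrix.mul_apply]
      refine Finset.sum_congr rfl fun d _ => ?_
      simp [mul_comm]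
    rw [e1]
    have hs := (hcs a b z hz.le).sub (hasSum_sum (s := Finset.univ) fun (i : Fin p) _ =>
      hasSum_sum (s := Finset.univ) fun (d : Fin n) _ =>
      ((hcs d b z hz.le).mul_left ((ξ.Φ i a d : ℂ) * z ^ ((i : ℕ) + 1))).shift ((i : ℕ) + 1))
    refine hs.congr_fun fun j => ?_
    simp only [sub_mul, Finset.sum_mul]
    congr 1
    refine Finset.sum_congr rfl fun i _ => Finset.sum_congr rfl fun d _ => ?_
    split_ifs with h
    · obtain ⟨m, rfl⟩ := Nat.exists_eq_add_of_le' h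
      rw [Nat.add_sub_cancel, pow_add]
      ring
    · simp
  have hD := ξ.eq_psi_of_recursion (D := fun j => Matrix.of fun a b => c a b j) fun j => by
    ext a b
    have := congrFun (hrec a b) j
    simp only [Matrix.sub_apply, Matrix.sum_apply, Matrix.of_apply, Matrix.map_apply]
    rw [← this]
    congr 1
    refine Finset.sum_congr rfl fun i _ => ?_
    split_ifs with h
    · simp [Matrix.mul_apply]
    · simp
  convert! hcs a b z hz using 2 with j
  rw [← Matrix.map_apply (f := fun x : ℝ => (x : ℂ)), ← hD]
  rfl

/-- The series converges at the boundary point z = 1, and convergence in ℂ is absolute. -/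
theorem summable_abs_psi (hAR : ∀ z : ℂ, ‖z‖ ≤ 1 → (ξ.arPoly z).det ≠ 0) (a b : Fin n) :
    Summable fun j => |ξ.psi j a b| := by
  have := summable_norm_iff.2 (ξ.hasSum_psi hAR (z := 1) (by simp) a b).summable
  simpa using this

end VARMAParam

-- Matrices of inner products and matrix action on tuples of vectors.

open scoped Matrix.Module

section Gram

variable {n : ℕ} {H : Type*} [NormedAddCommGroup H] [InnerProductSpace ℝ H]

/-- The matrix of inner products of two tuples of vectors. -/
def gram (x z : Fin n → H) : Matrix (Fin n) (Fin n) ℝ := Matrix.of fun i j => inner ℝ (x i) (z j)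

theorem gram_apply (x z : Fin n → H) (i j : Fin n) : gram x z i j = inner ℝ (x i) (z j) := rfl

theorem gram_transpose (x z : Fin n → H) : (gram x z)ᵀ = gram z x := by
  ext i j
  simp [gram_apply, real_inner_comm]

theorem gram_add_left (x y z : Fin n → H) : gram (x + y) z = gram x z + gram y z := by
  ext i j
  simp [gram_apply, inner_add_left]

theorem gram_sub_left (x y z : Fin n → H) : gram (x - y) z = gram x z - gram y z := by
  ext i j
  simp [gram_apply, inner_sub_left]

theorem gram_sum_left {ι : Type*} (s : Finset ι) (x : ι → Fin n → H) (z : Fin n → H) :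
    gram (∑ k ∈ s, x k) z = ∑ k ∈ s, gram (x k) z := by
  ext i j
  simp [gram_apply, sum_inner, Matrix.sum_apply]

theorem gram_smul_left (A : Matrix (Fin n) (Fin n) ℝ) (x z : Fin n → H) :
    gram (A • x) z = A * gram x z := by
  ext i j
  simp [gram_apply, sum_inner, Matrix.mul_apply, real_inner_smul_left]

theorem gram_zero_left (z : Fin n → H) : gram 0 z = 0 := by
  ext i j
  simp [gram_apply]

theorem gram_add_right (x y z : Fin n → H) : gram z (x + y) = gram z x + gram z y := by
  rw [← gram_transpose, gram_add_left, Matrix.transpose_add, gram_transpose, gram_transpose]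

theorem gram_sub_right (x y z : Fin n → H) : gram z (x - y) = gram z x - gram z y := by
  rw [← gram_transpose, gram_sub_left, Matrix.transpose_sub, gram_transpose, gram_transpose]

theorem gram_sum_right {ι : Type*} (s : Finset ι) (x : ι → Fin n → H) (z : Fin n → H) :
    gram z (∑ k ∈ s, x k) = ∑ k ∈ s, gram z (x k) := by
  rw [← gram_transpose, gram_sum_left, Matrix.transpose_sum]
  simp only [gram_transpose]

theorem gram_smul_right (A : Matrix (Fin n) (Fin n) ℝ) (x z : Fin n → H) :
    gram z (A • x) = gram z x * Aᵀ := by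
  rw [← gram_transpose, gram_smul_left, Matrix.transpose_mul, gram_transpose]

theorem HasSum.gram_left {ι : Type*} {f : ι → Fin n → H} {s : Fin n → H} (hf : HasSum f s)
    (z : Fin n → H) : HasSum (fun k => gram (f k) z) (gram s z) := by
  refine Pi.hasSum.2 fun i => Pi.hasSum.2 fun j => ?_
  have h := Pi.hasSum.1 hf i
  simp only [gram_apply]
  simpa only [innerSL_apply_apply, real_inner_comm] using h.mapL (innerSL ℝ (z j))

theorem HasSum.gram_right {ι : Type*} {f : ι → Fin n → H} {s : Fin n → H} (hf : HasSum f s)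
    (z : Fin n → H) : HasSum (fun k => gram z (f k)) (gram z s) := by
  have := (hf.gram_left z).matrix_transpose
  simpa only [gram_transpose] using this

theorem HasSum.matrix_smul {ι : Type*} {f : ι → Fin n → H} {s : Fin n → H} (hf : HasSum f s)
    (A : Matrix (Fin n) (Fin n) ℝ) : HasSum (fun k => A • f k) (A • s) := by
  refine Pi.hasSum.2 fun i => ?_
  exact hasSum_sum fun b _ => (Pi.hasSum.1 hf b).const_smul _

theorem summable_matrix_smul [CompleteSpace H] {A : ℕ → Matrix (Fin n) (Fin n) ℝ}
    (hA : ∀ a b, Summable fun j => |A j a b|) {x : ℕ → Fin n → H} {C : ℝ}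
    (hx : ∀ j i, ‖x j i‖ ≤ C) : Summable fun j => A j • x j := by
  refine Pi.summable.2 fun i => ?_
  refine summable_sum fun b _ => ?_
  refine .of_norm_bounded ((hA i b).mul_right C) fun j => ?_
  rw [norm_smul, Real.norm_eq_abs]
  exact mul_le_mul_of_nonneg_left (hx j b) (abs_nonneg _)

theorem norm_matrix_smul_le {C : ℝ} (A : Matrix (Fin n) (Fin n) ℝ) {x : Fin n → H}
    (hx : ∀ i, ‖x i‖ ≤ C) (i : Fin n) : ‖(A • x) i‖ ≤ (∑ a, ∑ b, |A a b|) * C := by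
  rw [Matrix.Module.smul_apply]
  have hC : 0 ≤ C := (norm_nonneg _).trans (hx i)
  calc ‖∑ b, A i b • x b‖ ≤ ∑ b, ‖A i b • x b‖ := norm_sum_le _ _
    _ ≤ ∑ b, |A i b| * C := Finset.sum_le_sum fun b _ => by
        rw [norm_smul, Real.norm_eq_abs]
        exact mul_le_mul_of_nonneg_left (hx b) (abs_nonneg _)
    _ = (∑ b, |A i b|) * C := by rw [Finset.sum_mul]
    _ ≤ _ := by
        refine mul_le_mul_of_nonneg_right ?_ hC
        exact Finset.single_le_sum (f := fun a => ∑ b, |A a b|)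
          (fun a _ => Finset.sum_nonneg fun b _ => abs_nonneg _) (Finset.mem_univ i)

end Gram

-- The causal representation in a Hilbert space.

namespace VARMAParam

variable {n p q : ℕ} (ξ : VARMAParam n p q)

/-- The pure autoregressive model with transposed coefficients. -/
def arTranspose : VARMAParam n p 0 := ⟨fun i => (ξ.Φ i)ᵀ, Fin.elim0, ξ.covEps⟩

theorem arTranspose_arPoly (z : ℂ) : ξ.arTranspose.arPoly z = (ξ.arPoly z)ᵀ := by
  simp [arPoly, arTranspose, Matrix.transpose_sub, Matrix.transpose_sum, Matrix.transpose_map]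

/-- Coefficients of the power series `Φ(z)⁻¹`. -/
def arInv (j : ℕ) : Matrix (Fin n) (Fin n) ℝ := (ξ.arTranspose.psi j)ᵀ

theorem summable_abs_arInv (hAR : ∀ z : ℂ, ‖z‖ ≤ 1 → (ξ.arPoly z).det ≠ 0) (a b : Fin n) :
    Summable fun j => |ξ.arInv j a b| :=
  ξ.arTranspose.summable_abs_psi
    (fun z hz => by rw [arTranspose_arPoly, Matrix.det_transpose]; exact hAR z hz) b a

/-- Transposing the recursion puts `Φ i` on the right, expressing Φ(z)⁻¹Φ(z) = I. That side is
needed because the inverse series is applied to vectors on which `Φ i` has already acted. -/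
theorem arInv_sub (j : ℕ) : ξ.arInv j - ∑ i : Fin p,
    (if (i : ℕ) + 1 ≤ j then ξ.arInv (j - ((i : ℕ) + 1)) * ξ.Φ i else 0) =
      if j = 0 then 1 else 0 := by
  rw [sub_eq_iff_eq_add, arInv, psi_eq, Matrix.transpose_add, Matrix.transpose_sum]
  congr 1
  · cases j <;> simp [ma]
  · refine Finset.sum_congr rfl fun i _ => ?_
    split_ifs
    · rw [Matrix.transpose_mul]
      rfl
    · simp

variable {H : Type*} [NormedAddCommGroup H] [InnerProductSpace ℝ H]

/-- A bounded solution on `ℤ` of the homogeneous causal autoregression vanishes. -/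
theorem eq_zero_of_homogeneous [CompleteSpace H]
    (hAR : ∀ z : ℂ, ‖z‖ ≤ 1 → (ξ.arPoly z).det ≠ 0)
    {D : ℤ → Fin n → H} {C : ℝ} (hD : ∀ t i, ‖D t i‖ ≤ C)
    (hrec : ∀ t, D t = ∑ i : Fin p, ξ.Φ i • D (t - ((i : ℤ) + 1))) (t : ℤ) : D t = 0 := by
  have hs : ∀ (A : Matrix (Fin n) (Fin n) ℝ) (t : ℤ),
      Summable fun j : ℕ => ξ.arInv j • A • D (t - j) := fun A t =>
    summable_matrix_smul (ξ.summable_abs_arInv hAR) fun j i => norm_matrix_smul_le A (hD _) i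
  have h1 : HasSum (fun j : ℕ => ξ.arInv j • D (t - j)) (∑' j : ℕ, ξ.arInv j • D (t - j)) :=
    (summable_matrix_smul (ξ.summable_abs_arInv hAR) fun j i => hD _ i).hasSum
  have h2 := hasSum_sum (s := Finset.univ) fun (i : Fin p) _ =>
    (hs (ξ.Φ i) (t - ((i : ℤ) + 1))).hasSum
  have h3 : (fun j : ℕ => ∑ i : Fin p, ξ.arInv j • ξ.Φ i • D (t - ((i : ℤ) + 1) - j)) =
      fun j : ℕ => ξ.arInv j • D (t - j) := by
    funext j
    rw [hrec (t - j), Finset.smul_sum]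
    refine Finset.sum_congr rfl fun i _ => ?_
    rw [sub_right_comm]
  have h4 := h2
  rw [h3] at h4
  -- The same double series, with the `i`-th part delayed by `i + 1`. Both arrangements have the
  -- same sum, while their termwise difference is Φ⁻¹Φ = I applied to `D`; thus `D t` equals 0.
  have h5 := hasSum_sum (s := Finset.univ) fun (i : Fin p) _ =>
    ((hs (ξ.Φ i) (t - ((i : ℤ) + 1))).hasSum).shift ((i : ℕ) + 1)
  have h6 := h1.sub h5
  rw [h4.unique h1, sub_self] at h6
  have h7 : (fun m : ℕ => ξ.arInv m • D (t - m) - ∑ i : Fin p, if (i : ℕ) + 1 ≤ m then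
      ξ.arInv (m - ((i : ℕ) + 1)) • ξ.Φ i •
        D (t - ((i : ℤ) + 1) - ((m - ((i : ℕ) + 1) : ℕ) : ℤ)) else 0) =
      fun m => if m = 0 then D t else 0 := by
    funext m
    have : (if m = 0 then D t else 0) =
        (if m = 0 then (1 : Matrix (Fin n) (Fin n) ℝ) else 0) • D (t - m) := by
      split_ifs with h
      · simp [h]
      · simp
    rw [this, ← arInv_sub, sub_smul, Finset.sum_smul]
    congr 1
    refine Finset.sum_congr rfl fun i _ => ?_
    split_ifs with h
    · rw [mul_smul]
      congr 3
      push_cast [h]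
      ring
    · simp
  rw [h7] at h6
  exact ((hasSum_ite_eq 0 (D t)).unique h6)

/-- A bounded solution `y` of the `VARMA` equation with noise `e` in a Hilbert space. -/
structure IsHilbertVARMA (y e : ℤ → Fin n → H) : Prop where
  gram_noise : ∀ s t, gram (e s) (e t) = if s = t then ξ.covEps else 0
  bounded : ∃ C, ∀ t i, ‖y t i‖ ≤ C
  equation : ∀ t, y t - ∑ i : Fin p, ξ.Φ i • y (t - ((i : ℤ) + 1)) =
    e t + ∑ i : Fin q, ξ.Θ i • e (t - ((i : ℤ) + 1))

namespace IsHilbertVARMA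

variable {ξ} {y e : ℤ → Fin n → H}

theorem noise_bounded (h : ξ.IsHilbertVARMA y e) : ∃ C, ∀ t i, ‖e t i‖ ≤ C := by
  refine ⟨∑ i, √(ξ.covEps i i), fun t i => ?_⟩
  have h1 : ‖e t i‖ = √(ξ.covEps i i) := by
    have := congrFun (congrFun (h.gram_noise t t) i) i
    rw [gram_apply, if_pos rfl, real_inner_self_eq_norm_sq] at this
    rw [← this, Real.sqrt_sq (norm_nonneg _)]
  rw [h1]
  exact Finset.single_le_sum (f := fun i => √(ξ.covEps i i)) (fun i _ => Real.sqrt_nonneg _)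
    (Finset.mem_univ i)

variable [CompleteSpace H]

/-- The causal representation `y_t = ∑ Ψ_j e_{t-j}`. -/
theorem hasSum_psi_smul (h : ξ.IsHilbertVARMA y e)
    (hAR : ∀ z : ℂ, ‖z‖ ≤ 1 → (ξ.arPoly z).det ≠ 0) (t : ℤ) :
    HasSum (fun j : ℕ => ξ.psi j • e (t - j)) (y t) := by
  obtain ⟨C, hC⟩ := h.bounded
  obtain ⟨C', hC'⟩ := h.noise_bounded
  have hsum : ∀ t : ℤ, Summable fun j : ℕ => ξ.psi j • e (t - j) := fun t =>
    summable_matrix_smul (ξ.summable_abs_psi hAR) fun j i => hC' _ i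
  set S : ℤ → Fin n → H := fun t => ∑' j : ℕ, ξ.psi j • e (t - j)
  have hSs : ∀ t, HasSum (fun j : ℕ => ξ.psi j • e (t - j)) (S t) := fun t => (hsum t).hasSum
  have hSeq : ∀ t, S t - ∑ i : Fin p, ξ.Φ i • S (t - ((i : ℤ) + 1)) =
      e t + ∑ i : Fin q, ξ.Θ i • e (t - ((i : ℤ) + 1)) := by
    intro t
    -- After alignment by lag the recursion for Ψ leaves only the moving average coefficients, a
    -- finite sum.
    have h1 := (hSs t).sub (hasSum_sum (s := Finset.univ) fun (i : Fin p) _ =>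
      ((hSs (t - ((i : ℤ) + 1))).matrix_smul (ξ.Φ i)).shift ((i : ℕ) + 1))
    have h2 : (fun m : ℕ => ξ.psi m • e (t - m) - ∑ i : Fin p, if (i : ℕ) + 1 ≤ m then
        ξ.Φ i • ξ.psi (m - ((i : ℕ) + 1)) •
          e (t - ((i : ℤ) + 1) - ((m - ((i : ℕ) + 1) : ℕ) : ℤ)) else 0) =
        fun m => ξ.ma m • e (t - m) := by
      funext m
      rw [eq_comm, eq_sub_iff_add_eq, ξ.psi_eq m, add_smul, Finset.sum_smul]
      congr 1
      refine Finset.sum_congr rfl fun i _ => ?_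
      split_ifs with h
      · rw [mul_smul]
        congr 3
        push_cast [h]
        ring
      · simp
    rw [h2] at h1
    have h3 : HasSum (fun m : ℕ => ξ.ma m • e (t - m))
        (∑ m ∈ Finset.range (q + 1), ξ.ma m • e (t - m)) :=
      hasSum_sum_of_ne_finset_zero fun m hm => by
        rw [ξ.ma_of_lt (by simpa using hm), zero_smul]
    rw [h1.unique h3, ξ.sum_range_ma (fun A m => A • e (t - (m : ℤ)))]
    simp
  have hSb : ∃ K, ∀ t i, ‖S t i‖ ≤ K := by
    refine ⟨∑ a, ∑ b, ∑' j, |ξ.psi j a b| * C', fun t i => ?_⟩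
    have h1 : S t i = ∑ b, ∑' j : ℕ, ξ.psi j i b • e (t - j) b := by
      have h2 : HasSum (fun j : ℕ => ∑ b, ξ.psi j i b • e (t - j) b)
          (∑ b, ∑' j : ℕ, ξ.psi j i b • e (t - j) b) := by
        refine hasSum_sum fun b _ => Summable.hasSum ?_
        refine .of_norm_bounded ((ξ.summable_abs_psi hAR i b).mul_right C') fun j => ?_
        rw [norm_smul, Real.norm_eq_abs]
        exact mul_le_mul_of_nonneg_left (hC' _ b) (abs_nonneg _)
      exact (Pi.hasSum.1 (hSs t) i).unique h2
    have hC0 : 0 ≤ C' := (norm_nonneg _).trans (hC' t i)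
    rw [h1]
    refine (norm_sum_le _ _).trans ((Finset.sum_le_sum fun b _ => ?_).trans
      (Finset.single_le_sum (f := fun a => ∑ b, ∑' j, |ξ.psi j a b| * C')
        (fun a _ => Finset.sum_nonneg fun b _ => tsum_nonneg fun j => by positivity)
        (Finset.mem_univ i)))
    refine tsum_of_norm_bounded ((ξ.summable_abs_psi hAR i b).mul_right C').hasSum fun j => ?_
    rw [norm_smul, Real.norm_eq_abs]
    exact mul_le_mul_of_nonneg_left (hC' _ b) (abs_nonneg _)
  obtain ⟨K, hK⟩ := hSb
  -- `y` and `S` are bounded and solve the same equation, so their difference is a bounded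
  -- homogeneous solution.
  have hD := ξ.eq_zero_of_homogeneous hAR (D := fun t => y t - S t) (C := C + K)
    (fun t i => (norm_sub_le _ _).trans (add_le_add (hC t i) (hK t i))) (fun t => by
      have := (h.equation t).trans (hSeq t).symm
      rw [sub_eq_sub_iff_add_eq_add] at this
      simp only [smul_sub, Finset.sum_sub_distrib]
      rw [sub_eq_sub_iff_add_eq_add, this, add_comm]) t
  rw [sub_eq_zero.1 hD]
  exact hSs t

/-- In the causal series only the term of lag `t - s` meets `e s`; noise in the future of `t` is
orthogonal to `y t`. -/
theorem gram_left_noise (h : ξ.IsHilbertVARMA y e)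
    (hAR : ∀ z : ℂ, ‖z‖ ≤ 1 → (ξ.arPoly z).det ≠ 0) (t s : ℤ) :
    gram (y t) (e s) = if s ≤ t then ξ.psi (t - s).toNat * ξ.covEps else 0 := by
  have h1 := (h.hasSum_psi_smul hAR t).gram_left (e s)
  refine h1.unique ?_
  have h2 : (fun j : ℕ => gram (ξ.psi j • e (t - j)) (e s)) =
      fun j : ℕ => if t - j = s then ξ.psi j * ξ.covEps else 0 := by
    funext j
    rw [gram_smul_left, h.gram_noise]
    split_ifs <;> simp
  rw [h2]
  split_ifs with hst
  · convert! hasSum_ite_eq (t - s).toNat (ξ.psi (t - s).toNat * ξ.covEps) using 2 with j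
    by_cases hj : t - j = s
    · have : j = (t - s).toNat := by omega
      rw [if_pos hj, if_pos this, this]
    · rw [if_neg hj, if_neg (by omega)]
  · convert! hasSum_zero using 2 with j
    rw [if_neg (by omega)]

/-- Expand `y (t - k)` causally. For negative `k` its first `(-k).toNat` terms involve noise later
than `t` and drop out, which accounts for the shifted index. -/
theorem hasSum_gammaY (h : ξ.IsHilbertVARMA y e)
    (hAR : ∀ z : ℂ, ‖z‖ ≤ 1 → (ξ.arPoly z).det ≠ 0) (t k : ℤ) :
    HasSum (fun j : ℕ => ξ.psi (j + k.toNat) * ξ.covEps * (ξ.psi (j + (-k).toNat))ᵀ)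
      (gram (y t) (y (t - k))) := by
  have h1 := (h.hasSum_psi_smul hAR (t - k)).gram_right (y t)
  have hinj : Function.Injective (fun j : ℕ => j + (-k).toNat) := add_left_injective _
  rw [← hinj.hasSum_iff] at h1
  · convert! h1 using 2 with j
    rw [Function.comp_apply, gram_smul_right, h.gram_left_noise hAR, if_pos (by omega)]
    congr 4
    omega
  · intro m hm
    rw [gram_smul_right, h.gram_left_noise hAR, if_neg, zero_mul]
    intro hle
    exact hm ⟨m - (-k).toNat, by simp only; omega⟩

theorem gram_eq_gammaY (h : ξ.IsHilbertVARMA y e)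
    (hAR : ∀ z : ℂ, ‖z‖ ≤ 1 → (ξ.arPoly z).det ≠ 0) (t k : ℤ) :
    gram (y t) (y (t - k)) = ξ.gammaY k :=
  (h.hasSum_gammaY hAR t k).tsum_eq.symm

theorem mem_topologicalClosure (h : ξ.IsHilbertVARMA y e)
    (hAR : ∀ z : ℂ, ‖z‖ ≤ 1 → (ξ.arPoly z).det ≠ 0) (t : ℤ) (i : Fin n) :
    y t i ∈ (Submodule.span ℝ
      (Set.range fun k : ℤ × Fin n => e k.1 k.2)).topologicalClosure := by
  have h1 := Pi.hasSum.1 (h.hasSum_psi_smul hAR t) i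
  refine (Submodule.isClosed_topologicalClosure _).mem_of_tendsto h1
    (Filter.Eventually.of_forall fun s => ?_)
  refine Submodule.sum_mem _ fun j _ => Submodule.sum_mem _ fun b _ => Submodule.smul_mem _ _ ?_
  exact Submodule.le_topologicalClosure _ (Submodule.subset_span ⟨(t - j, b), rfl⟩)

/-- The coordinates of `y` at finitely many consecutive times are linearly independent. -/
theorem eq_zero_of_sum_smul_eq_zero (h : ξ.IsHilbertVARMA y e)
    (hAR : ∀ z : ℂ, ‖z‖ ≤ 1 → (ξ.arPoly z).det ≠ 0) (hpos : ξ.covEps.PosDef) {T : ℕ}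
    {c : Fin T → Fin n → ℝ} (hc : ∑ k : Fin T, ∑ i, c k i • y ((k : ℤ) + 1) i = 0) : c = 0 := by
  have key : ∀ N : ℕ, ∀ k : Fin T, T - (k : ℕ) = N → c k = 0 := by
    intro N
    induction N using Nat.strong_induction_on with
    | _ N ih =>
      intro k hk
      by_contra hne
      -- Downward induction in time, pairing the relation with the noise at time `k + 1` in
      -- direction `c k`. Earlier observations are orthogonal to it and later coefficients already
      -- vanish, so c_kᵀ Σ_ε c_k = 0 because Ψ_0 = I.
      have h0 : inner ℝ (∑ m : Fin T, ∑ i, c m i • y ((m : ℤ) + 1) i)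
          (∑ j, c k j • e ((k : ℤ) + 1) j) = 0 := by rw [hc, inner_zero_left]
      have h1 : ∀ m : Fin T, inner ℝ (∑ i, c m i • y ((m : ℤ) + 1) i)
          (∑ j, c k j • e ((k : ℤ) + 1) j) =
          c m ⬝ᵥ (gram (y ((m : ℤ) + 1)) (e ((k : ℤ) + 1))) *ᵥ c k := by
        intro m
        simp only [sum_inner, inner_sum, real_inner_smul_left, real_inner_smul_right, dotProduct,
          Matrix.mulVec, gram_apply, Finset.mul_sum]
        rw [Finset.sum_comm]
        exact Finset.sum_congr rfl fun i _ => Finset.sum_congr rfl fun j _ => by ring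
      rw [sum_inner, Finset.sum_eq_single k] at h0
      · rw [h1, h.gram_left_noise hAR, if_pos le_rfl, sub_self, Int.toNat_zero, psi_zero,
          one_mul] at h0
        have := hpos.dotProduct_mulVec_pos hne
        simp only [star_trivial] at this
        exact this.ne' h0
      · intro m _ hm
        rw [h1]
        rcases lt_or_gt_of_ne hm with hlt | hgt
        · rw [h.gram_left_noise hAR, if_neg, Matrix.zero_mulVec, dotProduct_zero]
          have : (m : ℕ) < k := hlt
          omega
        · have hlt : (k : ℕ) < m := hgt
          rw [ih (T - m) (by omega) m rfl, zero_dotProduct]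
      · simp
  funext k
  exact key _ k rfl

end IsHilbertVARMA

end VARMAParam

-- Time reversal and the covariances of the forward transformation.

theorem HasSum.mul_prod {f g : ℕ → ℂ} {s t : ℂ} (hf : HasSum f s) (hg : HasSum g t) :
    HasSum (fun x : ℕ × ℕ => f x.1 * g x.2) (s * t) :=
  HasSum.mul (f := f) (g := g) hf hg
    (summable_mul_of_summable_norm (f := f) (g := g) (summable_norm_iff.2 hf.summable)
      (summable_norm_iff.2 hg.summable))

namespace VARMAParam

variable {n p q : ℕ} (ξ : VARMAParam n p q)

theorem hasSum_spectral (hAR : ∀ z : ℂ, ‖z‖ ≤ 1 → (ξ.arPoly z).det ≠ 0) {z w : ℂ}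
    (hz : ‖z‖ ≤ 1) (hw : ‖w‖ ≤ 1) (a b : Fin n) :
    HasSum (fun x : ℕ × ℕ => (((ξ.psi x.1 * ξ.covEps * (ξ.psi x.2)ᵀ) a b : ℝ) : ℂ) *
      (z ^ x.1 * w ^ x.2)) (ξ.spectral z w a b) := by
  have h1 : ξ.spectral z w a b = ∑ d, ∑ c, (ξ.covEps c d : ℂ) *
      (((ξ.arPoly z)⁻¹ * ξ.maPoly z) a c * ((ξ.arPoly w)⁻¹ * ξ.maPoly w) b d) := by
    rw [spectral, ← Matrix.transpose_nonsing_inv, Matrix.mul_assoc, ← Matrix.transpose_mul]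
    generalize (ξ.arPoly z)⁻¹ * ξ.maPoly z = F
    generalize (ξ.arPoly w)⁻¹ * ξ.maPoly w = F'
    simp only [Matrix.mul_apply, Matrix.transpose_apply, Matrix.map_apply, Finset.sum_mul]
    exact Finset.sum_congr rfl fun d _ => Finset.sum_congr rfl fun c _ => by ring
  rw [h1]
  have h0 : ∀ c d, HasSum (fun x : ℕ × ℕ => ((ξ.psi x.1 a c : ℂ) * z ^ x.1) *
      ((ξ.psi x.2 b d : ℂ) * w ^ x.2))
      (((ξ.arPoly z)⁻¹ * ξ.maPoly z) a c * ((ξ.arPoly w)⁻¹ * ξ.maPoly w) b d) := fun c d =>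
    HasSum.mul_prod (f := fun j => (ξ.psi j a c : ℂ) * z ^ j)
      (g := fun j => (ξ.psi j b d : ℂ) * w ^ j) (ξ.hasSum_psi hAR hz a c)
      (ξ.hasSum_psi hAR hw b d)
  have h2 := hasSum_sum (s := Finset.univ) fun (d : Fin n) _ =>
    hasSum_sum (s := Finset.univ) fun (c : Fin n) _ => (h0 c d).mul_left (ξ.covEps c d : ℂ)
  refine h2.congr_fun fun x => ?_
  simp only [Matrix.mul_apply, Matrix.transpose_apply, Finset.sum_mul, Complex.ofReal_sum,
    Complex.ofReal_mul]
  exact Finset.sum_congr rfl fun d _ => Finset.sum_congr rfl fun c _ => by ring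

/-- One of `h.toNat` and `(-h).toNat` is 0, so adding them to the two coordinates parametrizes the
pairs of difference `h` bijectively for either sign. -/
theorem hasSum_diagonal {f : ℕ × ℕ → ℂ} {X : ℂ} {h : ℤ}
    (hf : HasSum (fun x : ℕ × ℕ => if (x.1 : ℤ) - x.2 = h then f x else 0) X) :
    HasSum (fun m : ℕ => f (m + h.toNat, m + (-h).toNat)) X := by
  have hinj : Function.Injective (fun m : ℕ => (m + h.toNat, m + (-h).toNat)) := by
    intro a b hab
    simpa using congrArg Prod.fst hab
  rw [← hinj.hasSum_iff] at hf
  · convert! hf using 2 with m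
    rw [Function.comp_apply, if_pos]
    push_cast
    omega
  · rintro ⟨j, k⟩ hjk
    rw [if_neg]
    intro he
    refine hjk ⟨j - h.toNat, ?_⟩
    simp only [Prod.mk.injEq]
    simp only at he
    omega

/-- On the circle the spectral matrix is ∑ Ψ_j Σ_ε Ψ_kᵀ z^(j-k), whose Fourier coefficient of order
`h` is Γ_Y(h). Replacing z by z⁻¹ reverses the exponents, and the symmetry hypothesis says that the
function does not change. -/
theorem gammaY_neg (hAR : ∀ z : ℂ, ‖z‖ ≤ 1 → (ξ.arPoly z).det ≠ 0)
    (hSym : ξ.SymmetricCovariance) (h : ℤ) : ξ.gammaY (-h) = ξ.gammaY h := by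
  set f : Fin n → Fin n → ℕ × ℕ → ℂ := fun a b x =>
    (((ξ.psi x.1 * ξ.covEps * (ξ.psi x.2)ᵀ) a b : ℝ) : ℂ)
  have hsum : ∀ a b, Summable fun x => ‖f a b x‖ := fun a b => by
    have := (ξ.hasSum_spectral hAR (z := 1) (w := 1) (by simp) (by simp) a b).summable.norm
    simpa [f] using this
  have hpow : ∀ (z : ℂ), ‖z‖ = 1 → ∀ j k : ℕ, z ^ ((j : ℤ) - k) = z ^ j * z⁻¹ ^ k := by
    intro z hz j k
    have hz0 : z ≠ 0 := by
      rintro rfl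
      simp at hz
    rw [zpow_sub₀ hz0, zpow_natCast, zpow_natCast, inv_pow, div_eq_mul_inv]
  have key : ∀ a b, ∃ X : ℂ,
      HasSum (fun m : ℕ => f a b (m + h.toNat, m + (-h).toNat)) X ∧
      HasSum (fun m : ℕ => f a b (m + (-h).toNat, m + (- -h).toNat)) X := by
    intro a b
    have k1 := hasSum_fourier (hsum a b) (fun x => (x.1 : ℤ) - x.2)
      (G := fun z => ξ.spectral z z⁻¹ a b) (fun z hz => by
        have := ξ.hasSum_spectral hAR (z := z) (w := z⁻¹) hz.le (by simp [hz]) a b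
        simpa only [hpow z hz] using this) h
    -- The same function `G` and order `h`, but expanded through the reversed spectral matrix: the
    -- integral, hence the sum `X`, coincides with that of `k1`.
    have k2 := hasSum_fourier (hsum a b) (fun x => (x.2 : ℤ) - x.1)
      (G := fun z => ξ.spectral z z⁻¹ a b) (fun z hz => by
        have := ξ.hasSum_spectral hAR (z := z⁻¹) (w := z) (by simp [hz]) hz.le a b
        rw [← hSym z hz] at this
        simpa only [hpow z hz, mul_comm (z⁻¹ ^ _)] using this) h
    refine ⟨_, hasSum_diagonal k1, hasSum_diagonal ?_⟩
    refine k2.congr_fun fun x => ?_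
    congr 1
    rw [eq_iff_iff]
    omega
  choose X hX hX' using key
  have hre : ∀ g : ℕ → Matrix (Fin n) (Fin n) ℝ,
      (∀ a b, HasSum (fun m => ((g m a b : ℝ) : ℂ)) (X a b)) →
      ∑' m, g m = Matrix.of fun a b => (X a b).re := by
    intro g hg
    refine HasSum.tsum_eq (Pi.hasSum.2 fun a => Pi.hasSum.2 fun b => ?_)
    simpa using Complex.hasSum_re (hg a b)
  rw [gammaY, gammaY, hre _ hX, hre _ hX']

section Transform

variable {M : Type*} [AddCommGroup M] [Module ℝ M]

/-- The forward transformation `y_t - ∑ Φ_i y_{t+i}`. -/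
def forward (y : ℤ → Fin n → M) (t : ℤ) : Fin n → M :=
  y t - ∑ i : Fin p, ξ.Φ i • y (t + ((i : ℤ) + 1))

/-- The backward transformation `y_t - ∑ Φ_i y_{t-i}`. -/
def backward (y : ℤ → Fin n → M) (t : ℤ) : Fin n → M :=
  y t - ∑ i : Fin p, ξ.Φ i • y (t - ((i : ℤ) + 1))

/-- The transformed process for a sample of length `T`. -/
def transformed (T : ℕ) (y : ℤ → Fin n → M) (t : ℕ) : Fin n → M :=
  if t + max p q ≤ T then ξ.forward y t else y t

end Transform

variable {H : Type*} [NormedAddCommGroup H] [InnerProductSpace ℝ H]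

variable {ξ} {y e : ℤ → Fin n → H}

/-- Reversing time turns leads into lags. Only second moments are involved, so their invariance
suffices. -/
theorem gram_forward_forward (hrev : ∀ a b, gram (y (-a)) (y (-b)) = gram (y a) (y b)) (a b : ℤ) :
    gram (ξ.forward y a) (ξ.forward y b) = gram (ξ.backward y (-a)) (ξ.backward y (-b)) := by
  have hi : ∀ (a : ℤ) (i : Fin p), -a - ((i : ℤ) + 1) = -(a + ((i : ℤ) + 1)) := fun a i => by ring
  simp only [forward, backward, gram_sub_left, gram_sub_right, gram_sum_left, gram_sum_right,
    gram_smul_left, gram_smul_right, hi, hrev]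

theorem gram_forward_right (hrev : ∀ a b, gram (y (-a)) (y (-b)) = gram (y a) (y b)) (a b : ℤ) :
    gram (y a) (ξ.forward y b) = gram (y (-a)) (ξ.backward y (-b)) := by
  have hi : ∀ (a : ℤ) (i : Fin p), -a - ((i : ℤ) + 1) = -(a + ((i : ℤ) + 1)) := fun a i => by ring
  simp only [forward, backward, gram_sub_right, gram_sum_right, gram_smul_right, hi, hrev]

namespace IsHilbertVARMA

theorem backward_eq (h : ξ.IsHilbertVARMA y e) (t : ℤ) :
    ξ.backward y t = ∑ k ∈ Finset.range (q + 1), ξ.ma k • e (t - k) := by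
  rw [backward, h.equation, ξ.sum_range_ma (fun A k => A • e (t - (k : ℤ)))]
  simp

/-- The backward transformation is the moving average of the noise, so only equal noise times
contribute. -/
theorem gram_backward (h : ξ.IsHilbertVARMA y e) (a : ℤ) (k : ℕ) :
    gram (ξ.backward y a) (ξ.backward y (a + k)) =
      ∑ i ∈ Finset.range (q + 1), ξ.ma i * ξ.covEps * (ξ.ma (i + k))ᵀ := by
  rw [h.backward_eq, h.backward_eq, gram_sum_left]
  refine Finset.sum_congr rfl fun i hi => ?_
  rw [gram_sum_right]
  have h1 : ∀ m ∈ Finset.range (q + 1), m ≠ i + k →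
      gram (ξ.ma i • e (a - i)) (ξ.ma m • e (a + k - m)) = 0 := by
    intro m _ hm
    rw [gram_smul_left, gram_smul_right, h.gram_noise, if_neg (by omega)]
    simp
  rw [Finset.sum_eq_single (i + k) h1]
  · rw [gram_smul_left, gram_smul_right, h.gram_noise, if_pos (by push_cast; ring),
      Matrix.mul_assoc]
  · intro hm
    rw [ξ.ma_of_lt (k := i + k) (by simpa using hm), zero_smul, ← gram_transpose, gram_zero_left,
      Matrix.transpose_zero]

theorem gram_backward_eq (h : ξ.IsHilbertVARMA y e) (a : ℤ) (k : ℕ) :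
    gram (ξ.backward y a) (ξ.backward y (a + k)) = if k ≤ q then
      ∑ i ∈ Finset.range (q - k + 1), ξ.ma i * ξ.covEps * (ξ.ma (i + k))ᵀ else 0 := by
  rw [h.gram_backward]
  split_ifs with hk
  · symm
    refine Finset.sum_subset (Finset.range_mono (by omega)) fun i _ hi => ?_
    rw [ξ.ma_of_lt (k := i + k) (by simp at hi; omega)]
    simp
  · refine Finset.sum_eq_zero fun i _ => ?_
    rw [ξ.ma_of_lt (k := i + k) (by omega)]
    simp

variable [CompleteSpace H]

theorem gram_backward_right_eq_zero (h : ξ.IsHilbertVARMA y e)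
    (hAR : ∀ z : ℂ, ‖z‖ ≤ 1 → (ξ.arPoly z).det ≠ 0) {a b : ℤ} (hab : a + q < b) :
    gram (y a) (ξ.backward y b) = 0 := by
  rw [h.backward_eq, gram_sum_right]
  refine Finset.sum_eq_zero fun k hk => ?_
  have : k < q + 1 := by simpa using hk
  rw [gram_smul_right, h.gram_left_noise hAR, if_neg (by omega), zero_mul]

theorem gram_neg_neg (h : ξ.IsHilbertVARMA y e)
    (hAR : ∀ z : ℂ, ‖z‖ ≤ 1 → (ξ.arPoly z).det ≠ 0) (hSym : ξ.SymmetricCovariance) (a b : ℤ) :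
    gram (y (-a)) (y (-b)) = gram (y a) (y b) := by
  have h1 := h.gram_eq_gammaY hAR a (a - b)
  have h2 := h.gram_eq_gammaY hAR (-a) (-(a - b))
  rw [show a - (a - b) = b by ring] at h1
  rw [show -a - -(a - b) = -b by ring] at h2
  rw [h1, h2, ξ.gammaY_neg hAR hSym]

/-- `Γ_W` is the covariance of the transformed process. -/
theorem gram_transformed (h : ξ.IsHilbertVARMA y e)
    (hAR : ∀ z : ℂ, ‖z‖ ≤ 1 → (ξ.arPoly z).det ≠ 0) (hSym : ξ.SymmetricCovariance)
    {T s t : ℕ} (hst : s ≤ t) :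
    gram (ξ.transformed T y t) (ξ.transformed T y s) = ξ.gammaW T t s := by
  have hrev := h.gram_neg_neg hAR hSym
  have hts : ((t - s : ℕ) : ℤ) = t - s := by push_cast [hst]; ring
  have hYY : ∀ a b : ℤ, gram (y a) (y b) = ξ.gammaY (a - b) := fun a b => by
    rw [← h.gram_eq_gammaY hAR a (a - b), sub_sub_cancel]
  simp only [gammaW, transformed]
  by_cases ht : T < t + max p q
  · rw [if_neg (by omega : ¬ t + max p q ≤ T), if_pos ht]
    by_cases hs : T < s + max p q
    · rw [if_neg (by omega : ¬ s + max p q ≤ T), if_pos hs, hYY, hts]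
    · rw [if_pos (by omega : s + max p q ≤ T), if_neg hs]
      by_cases hs2 : T < s + 2 * max p q
      · rw [if_pos hs2, forward, gram_sub_right, gram_sum_right, hYY, hts]
        congr 1
        refine Finset.sum_congr rfl fun i _ => ?_
        rw [gram_smul_right, hYY, sub_add_eq_sub_sub]
      -- After reversal, `-s` exceeds `-t` by more than `l ≥ q`, so the moving average at `-s` uses
      -- only noise in the future of `-t`.
      · rw [if_neg hs2, gram_forward_right hrev, h.gram_backward_right_eq_zero hAR]
        have := le_max_right p q
        omega
  · rw [if_pos (by omega : t + max p q ≤ T), if_pos (by omega : s + max p q ≤ T), if_neg ht,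
      gram_forward_forward hrev, show -(s : ℤ) = -t + (t - s : ℕ) by rw [hts]; ring,
      h.gram_backward_eq]

end IsHilbertVARMA

end VARMAParam

-- The innovations algorithm as block Gram–Schmidt.

section Innovations

variable {n : ℕ} (K : ℕ → ℕ → Matrix (Fin n) (Fin n) ℝ)

/-- Indexing by the absolute time `s` instead of the lag suits inductions over the past. -/
theorem innovCoef_eq {s t : ℕ} (hst : s < t) : innovCoef K t (t - s) =
    (K (t + 1) (s + 1) - ∑ k ∈ Finset.range s, innovCoef K t (t - k) * innovCov K (k + 1) *
      (innovCoef K s (s - k))ᵀ) * (innovCov K (s + 1))⁻¹ := by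
  rw [innovCoef, dif_pos (by omega)]
  have h : t - (t - s) = s := by omega
  rw [← Finset.sum_range (fun k => innovCoef K t (t - k) * innovCov K (k + 1) *
    (innovCoef K (t - (t - s)) (t - (t - s) - k))ᵀ), h]

theorem innovCov_eq (t : ℕ) : innovCov K (t + 1) = K (t + 1) (t + 1) -
    ∑ k ∈ Finset.range t, innovCoef K t (t - k) * innovCov K (k + 1) * (innovCoef K t (t - k))ᵀ := by
  rw [innovCov]
  simp only [Nat.add_sub_cancel]
  rw [← Finset.sum_range (fun j => innovCoef K t (j + 1) * innovCov K (t + 1 - (j + 1)) *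
    (innovCoef K t (j + 1))ᵀ), ← Finset.sum_range_reflect]
  congr 1
  refine Finset.sum_congr rfl fun k hk => ?_
  have hk' : k < t := by simpa using hk
  rw [show t + 1 - 1 - 1 - k + 1 = t - k by omega, show t + 1 - (t - k) = k + 1 by omega]

section Module

variable {M M' : Type*} [AddCommGroup M] [Module ℝ M] [AddCommGroup M'] [Module ℝ M']

/-- The innovations `w_t - ŵ_t` of a sequence `w_1, w_2, …` of tuples of vectors. -/
def innovSeq (w : ℕ → Fin n → M) : ℕ → Fin n → M
  | 0 => w 0
  | t + 1 => w (t + 1) - ∑ k : Fin t, innovCoef K t (t - (k : ℕ)) • innovSeq w ((k : ℕ) + 1)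

theorem innovSeq_succ (w : ℕ → Fin n → M) (t : ℕ) : innovSeq K w (t + 1) =
    w (t + 1) - ∑ k ∈ Finset.range t, innovCoef K t (t - k) • innovSeq K w (k + 1) := by
  rw [innovSeq, Finset.sum_range]

/-- The algorithm is linear in the sequence, so innovations computed among functionals of the sample
agree with those computed among their L² classes. -/
theorem map_innovSeq (φ : M →ₗ[ℝ] M') (w : ℕ → Fin n → M) (t : ℕ) (i : Fin n) :
    φ (innovSeq K w t i) = innovSeq K (fun t i => φ (w t i)) t i := by
  induction t using Nat.strong_induction_on generalizing i with
  | _ t ih =>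
    cases t with
    | zero => simp [innovSeq]
    | succ t =>
      rw [innovSeq_succ, innovSeq_succ]
      simp only [Pi.sub_apply, Finset.sum_apply, map_sub, map_sum,
        Matrix.Module.smul_apply, map_smul]
      congr 1
      refine Finset.sum_congr rfl fun k hk => Finset.sum_congr rfl fun j _ => ?_
      rw [ih _ (by simpa using hk)]

end Module

variable {H : Type*} [NormedAddCommGroup H] [InnerProductSpace ℝ H]

/-- The recursion for the coefficients is the Gram–Schmidt condition solved for Θ_{t,t-s}, which
requires Σ_{s+1} to be invertible. Positivity is assumed for the actual Gram matrices, as it will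
follow from unitriangularity without knowing that the algorithm is correct. -/
theorem gram_innovSeq {K} {w : ℕ → Fin n → H} {T : ℕ}
    (hK : ∀ s t, 1 ≤ s → s ≤ t → t ≤ T → gram (w t) (w s) = K t s)
    (hpos : ∀ t, 1 ≤ t → t ≤ T → (gram (innovSeq K w t) (innovSeq K w t)).PosDef) (t : ℕ)
    (ht : t + 1 ≤ T) :
    gram (innovSeq K w (t + 1)) (innovSeq K w (t + 1)) = innovCov K (t + 1) ∧
      ∀ s, s < t → gram (innovSeq K w (t + 1)) (innovSeq K w (s + 1)) = 0 := by
  induction t using Nat.strong_induction_on with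
  | _ t ih =>
    have hdiag : ∀ k s, k < t → s < t → gram (innovSeq K w (k + 1)) (innovSeq K w (s + 1)) =
        if k = s then innovCov K (s + 1) else 0 := by
      intro k s hk hs
      rcases lt_trichotomy k s with h | h | h
      · rw [if_neg h.ne, ← gram_transpose, (ih s hs (by omega)).2 k h, Matrix.transpose_zero]
      · rw [if_pos h, h, (ih s hs (by omega)).1]
      · rw [if_neg h.ne', (ih k hk (by omega)).2 s h]
    have hcross : ∀ s, s < t → gram (w (t + 1)) (innovSeq K w (s + 1)) =
        innovCoef K t (t - s) * innovCov K (s + 1) := by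
      intro s
      induction s using Nat.strong_induction_on with
      | _ s ihs =>
        intro hs
        have hu : IsUnit (innovCov K (s + 1)).det := by
          rw [← (ih s hs (by omega)).1]
          exact (hpos (s + 1) (by omega) (by omega)).det_pos.ne'.isUnit
        rw [innovCoef_eq K hs, Matrix.nonsing_inv_mul_cancel_right _ _ hu, innovSeq_succ,
          gram_sub_right, gram_sum_right, hK _ _ (by omega) (by omega) ht]
        congr 1
        refine Finset.sum_congr rfl fun k hk => ?_
        have hk' : k < s := by simpa using hk
        rw [gram_smul_right, ihs k hk' (by omega)]
    have horth : ∀ s, s < t → gram (innovSeq K w (t + 1)) (innovSeq K w (s + 1)) = 0 := by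
      intro s hs
      rw [innovSeq_succ K w t, gram_sub_left, gram_sum_left, hcross s hs,
        Finset.sum_eq_single_of_mem s (by simpa using hs)]
      · rw [gram_smul_left, hdiag s s hs hs, if_pos rfl, sub_self]
      · intro k hk hks
        rw [gram_smul_left, hdiag k s (by simpa using hk) hs, if_neg hks, mul_zero]
    refine ⟨?_, horth⟩
    -- The subtracted predictor is a combination of earlier innovations, to which the new one is
    -- orthogonal.
    have h1 : gram (innovSeq K w (t + 1)) (innovSeq K w (t + 1)) =
        gram (innovSeq K w (t + 1)) (w (t + 1)) := by
      conv_lhs => rw [innovSeq_succ K w t, gram_sub_right, gram_sum_right, ← innovSeq_succ]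
      rw [Finset.sum_eq_zero, sub_zero]
      intro k hk
      rw [gram_smul_right, horth k (by simpa using hk), zero_mul]
    rw [h1, innovSeq_succ, gram_sub_left, gram_sum_left, hK _ _ (by omega) le_rfl ht, innovCov_eq]
    congr 1
    refine Finset.sum_congr rfl fun k hk => ?_
    have hk' : k < t := by simpa using hk
    rw [gram_smul_left, ← gram_transpose, hcross k hk', Matrix.transpose_mul,
      ← (ih k hk' (by omega)).1, gram_transpose, Matrix.mul_assoc]

end Innovations

-- Unitriangular maps, product densities and linear change of variables.

/-- Testing the hypothesis on basis vectors shows that the matrix is block triangular for the rank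
`r` with identity diagonal blocks. The rank is arbitrary so that time may be ordered forwards or
backwards. -/
theorem LinearMap.det_eq_one_of_unitriangular {ι κ : Type*} [Fintype ι] [DecidableEq ι]
    [Fintype κ] [DecidableEq κ] {r : ι → ℕ}
    {L : (ι → κ → ℝ) →ₗ[ℝ] (ι → κ → ℝ)}
    (h : ∀ y t, (∀ s, r s < r t → y s = 0) → L y t = y t) : LinearMap.det L = 1 := by
  set b := Pi.basis (fun _ : ι => Pi.basisFun ℝ κ)
  have hM : ∀ i j : (_ : ι) × κ, r i.1 ≤ r j.1 →
      LinearMap.toMatrix b b L i j = if i = j then 1 else 0 := by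
    rintro ⟨t, a⟩ ⟨s, c⟩ hij
    rw [LinearMap.toMatrix_apply]
    simp only [b, Pi.basis_apply, Pi.basis_repr, Pi.basisFun_repr, Pi.basisFun_apply]
    rw [h]
    · by_cases hts : t = s
      · subst hts
        simp [Pi.single_apply]
      · rw [Pi.single_eq_of_ne hts, if_neg (by simp [hts])]
        rfl
    · intro u hu
      rw [Pi.single_eq_of_ne]
      rintro rfl
      exact absurd hu (not_lt.2 hij)
  rw [← LinearMap.det_toMatrix b, ← Matrix.det_transpose, Matrix.BlockTriangular.det
    (b := fun i : (_ : ι) × κ => r i.1)]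
  · refine Finset.prod_eq_one fun k _ => ?_
    have h1 : (LinearMap.toMatrix b b L)ᵀ.toSquareBlock (fun i => r i.1) k = 1 := by
      ext ⟨i, hi⟩ ⟨j, hj⟩
      rw [Matrix.toSquareBlock_def, Matrix.of_apply, Matrix.transpose_apply,
        hM _ _ (hj.trans hi.symm).le, Matrix.one_apply]
      simp [eq_comm]
    rw [h1, Matrix.det_one]
  · intro i j hij
    rw [Matrix.transpose_apply, hM _ _ hij.le, if_neg]
    rintro rfl
    exact absurd hij (lt_irrefl _)

section Density

theorem MeasureTheory.Measure.pi_eq_withDensity {ι : Type*} [Fintype ι] {α : ι → Type*}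
    [∀ i, MeasurableSpace (α i)] (μ ν : ∀ i, Measure (α i)) [∀ i, SigmaFinite (μ i)]
    [∀ i, SigmaFinite (ν i)] {g : ∀ i, α i → ℝ} (hg0 : ∀ i x, 0 ≤ g i x)
    (hg : ∀ i, Integrable (g i) (μ i))
    (hν : ∀ i, ν i = (μ i).withDensity fun x => ENNReal.ofReal (g i x)) :
    Measure.pi ν = (Measure.pi μ).withDensity fun x => ENNReal.ofReal (∏ i, g i (x i)) := by
  refine Measure.pi_eq fun s hs => ?_
  rw [withDensity_apply _ (MeasurableSet.univ_pi hs), Measure.restrict_pi_pi,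
    ← ofReal_integral_eq_lintegral_ofReal
      (Integrable.fintype_prod_dep fun i => (hg i).restrict)
      (Filter.Eventually.of_forall fun x => Finset.prod_nonneg fun i _ => hg0 i _),
    integral_fintype_prod_eq_prod, ENNReal.ofReal_prod_of_nonneg
      (fun i _ => integral_nonneg (hg0 i))]
  refine Finset.prod_congr rfl fun i _ => ?_
  rw [hν, withDensity_apply _ (hs i), ofReal_integral_eq_lintegral_ofReal (hg i).restrict
    (Filter.Eventually.of_forall (hg0 i))]

/-- The standard Gaussian density on `ι → κ → ℝ`. -/
theorem pi_pi_gaussianReal_eq_withDensity (ι κ : Type*) [Fintype ι] [Fintype κ] :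
    Measure.pi (fun _ : ι => Measure.pi fun _ : κ => gaussianReal 0 1) =
      (volume : Measure (ι → κ → ℝ)).withDensity fun x =>
        ENNReal.ofReal (∏ i, ∏ j, gaussianPDFReal 0 1 (x i j)) := by
  have h1 := Measure.pi_eq_withDensity (fun _ : κ => (volume : Measure ℝ))
    (fun _ : κ => gaussianReal 0 1) (g := fun _ => gaussianPDFReal 0 1)
    (fun _ x => gaussianPDFReal_nonneg 0 1 x) (fun _ => integrable_gaussianPDFReal 0 1)
    (fun _ => gaussianReal_of_var_ne_zero 0 one_ne_zero)
  exact Measure.pi_eq_withDensity (fun _ : ι => (volume : Measure (κ → ℝ)))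
    (fun _ : ι => Measure.pi fun _ : κ => gaussianReal 0 1)
    (g := fun _ x => ∏ j, gaussianPDFReal 0 1 (x j))
    (fun _ x => Finset.prod_nonneg fun j _ => gaussianPDFReal_nonneg 0 1 _)
    (fun _ => Integrable.fintype_prod_dep fun j => integrable_gaussianPDFReal 0 1) (fun _ => h1)

/-- Change of variables for densities under an invertible linear map. -/
theorem map_eq_withDensity_of_linearMap {Ω E : Type*} [MeasurableSpace Ω] {P : Measure Ω}
    [NormedAddCommGroup E] [NormedSpace ℝ E] [FiniteDimensional ℝ E] [MeasureSpace E]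
    [BorelSpace E] [(volume : Measure E).IsAddHaarMeasure] {Y : Ω → E} (hY : Measurable Y)
    {L : E →ₗ[ℝ] E} (hL : LinearMap.det L ≠ 0) {f : E → ENNReal}
    (h : P.map (fun ω => L (Y ω)) = volume.withDensity f) :
    P.map Y = volume.withDensity fun y => ENNReal.ofReal |LinearMap.det L| * f (L y) := by
  set e := (LinearMap.equivOfDetNeZero L hL).toContinuousLinearEquiv
  have hLe : ∀ y, L y = e y := fun y => rfl
  have hinj : Function.Injective L := fun a b hab => e.injective hab
  ext s hs
  have hs' : MeasurableSet (L '' s) := by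
    have : L '' s = e.symm ⁻¹' s := by
      ext x
      constructor
      · rintro ⟨y, hy, rfl⟩
        simpa [hLe] using hy
      · intro hx
        exact ⟨e.symm x, hx, by simp [hLe]⟩
    rw [this]
    exact e.symm.continuous.measurable hs
  have hLm : Measurable L := e.continuous.measurable
  -- Evaluating on an image makes the change of variables formula return an integral over `s`
  -- itself.
  have h1 : P.map (fun ω => L (Y ω)) (L '' s) = volume.withDensity f (L '' s) := by rw [h]
  rw [Measure.map_apply (f := fun ω => L (Y ω)) (hLm.comp hY) hs', withDensity_apply _ hs',
    lintegral_image_eq_lintegral_abs_det_fderiv_mul volume hs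
      (f := L) (f' := fun _ => (e : E →L[ℝ] E)) (fun x _ => e.hasFDerivAt.hasFDerivWithinAt)
      hinj.injOn] at h1
  rw [Measure.map_apply hY hs, withDensity_apply _ hs]
  have h2 : (fun ω => L (Y ω)) ⁻¹' (L '' s) = Y ⁻¹' s := by
    ext ω
    exact hinj.mem_set_image
  rw [← h2, h1]
  rfl

end Density

-- Centered Gaussian elements of L².

section HilbertProbability

variable {Ω : Type*} [MeasurableSpace Ω] {P : Measure Ω}

/-- The square-integrable functions. -/
def sqIntegrable (P : Measure Ω) : Submodule ℝ (Ω → ℝ) where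
  carrier := {f | MemLp f 2 P}
  add_mem' := fun hf hg => hf.add hg
  zero_mem' := MemLp.zero
  smul_mem' := fun c _ hf => hf.const_smul c

/-- The class in `L²` of a square-integrable function. -/
def sqClass (P : Measure Ω) : sqIntegrable P →ₗ[ℝ] Lp ℝ 2 P where
  toFun f := f.2.toLp f.1
  map_add' f g := MemLp.toLp_add f.2 g.2
  map_smul' c f := MemLp.toLp_const_smul c f.2

theorem sqClass_mk {f : Ω → ℝ} (hf : MemLp f 2 P) : sqClass P ⟨f, hf⟩ = hf.toLp f := rfl

theorem coeFn_sqClass (f : sqIntegrable P) : sqClass P f =ᵐ[P] f.1 := f.2.coeFn_toLp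

theorem sqClass_congr {f g : sqIntegrable P} (h : f.1 =ᵐ[P] g.1) : sqClass P f = sqClass P g :=
  (MemLp.toLp_eq_toLp_iff f.2 g.2).2 h

theorem inner_toLp_eq_covariance [IsProbabilityMeasure P] {f g : Ω → ℝ} (hf : MemLp f 2 P)
    (hg : MemLp g 2 P) (hf0 : ∫ ω, f ω ∂P = 0) :
    inner ℝ (hf.toLp f) (hg.toLp g) = cov[f, g; P] := by
  rw [covariance_eq_sub hf hg, hf0, zero_mul, sub_zero, L2.inner_def]
  refine integral_congr_ae ?_
  filter_upwards [hf.coeFn_toLp, hg.coeFn_toLp] with ω h1 h2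
  rw [h1, h2, Pi.mul_apply, mul_comm]
  rfl

/-- The square-integrable variables which are centered Gaussian with variance `‖x‖²`. -/
def gaussianSet (P : Measure Ω) : Set (Lp ℝ 2 P) :=
  {x | ∫ ω, Complex.exp (x ω * Complex.I) ∂P = Complex.exp (-(‖x‖ ^ 2 : ℝ) / 2)}

theorem norm_exp_mul_I_sub_le (a b : ℝ) :
    ‖Complex.exp (a * Complex.I) - Complex.exp (b * Complex.I)‖ ≤ |a - b| := by
  have h1 : Complex.exp (a * Complex.I) - Complex.exp (b * Complex.I) =
      Complex.exp (b * Complex.I) * (Complex.exp (Complex.I * ((a - b : ℝ) : ℂ)) - 1) := by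
    rw [mul_sub, mul_one, ← Complex.exp_add]
    congr 2
    push_cast
    ring
  rw [h1, norm_mul, Complex.norm_exp_ofReal_mul_I, one_mul]
  exact Real.norm_exp_I_mul_ofReal_sub_one_le

theorem integral_abs_sub_le_norm_sub [IsProbabilityMeasure P] (x y : Lp ℝ 2 P) :
    ∫ ω, |x ω - y ω| ∂P ≤ ‖x - y‖ := by
  have h1 : ∫ ω, |x ω - y ω| ∂P = (eLpNorm (x - y : Lp ℝ 2 P) 1 P).toReal := by
    have h2 : ∫ ω, |x ω - y ω| ∂P = ∫ ω, ‖(x - y : Lp ℝ 2 P) ω‖ ∂P := by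
      refine integral_congr_ae ?_
      filter_upwards [Lp.coeFn_sub x y] with ω hω
      rw [hω, Real.norm_eq_abs]
      rfl
    rw [h2, integral_norm_eq_lintegral_enorm (Lp.aestronglyMeasurable _),
      eLpNorm_one_eq_lintegral_enorm]
  rw [h1, Lp.norm_def]
  exact ENNReal.toReal_mono (Lp.eLpNorm_ne_top _)
    (eLpNorm_le_eLpNorm_of_exponent_le (by norm_num) (Lp.aestronglyMeasurable _))

theorem integrable_exp_mul_I [IsFiniteMeasure P] {f : Ω → ℝ} (hf : AEStronglyMeasurable f P) :
    Integrable (fun ω => Complex.exp (f ω * Complex.I)) P := by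
  refine .of_bound (C := 1) ?_ (Filter.Eventually.of_forall fun ω => ?_)
  · exact (Continuous.comp_aestronglyMeasurable
      (g := fun x : ℝ => Complex.exp (x * Complex.I)) (by fun_prop) hf)
  · rw [Complex.norm_exp_ofReal_mul_I]

/-- The map x ↦ E exp(ix) is 1-Lipschitz, since |exp(ia) - exp(ib)| ≤ |a - b| and the L¹ norm is at
most the L² norm; the right-hand side is continuous too. -/
theorem isClosed_gaussianSet [IsProbabilityMeasure P] : IsClosed (gaussianSet P) := by
  have h1 : Continuous fun x : Lp ℝ 2 P => ∫ ω, Complex.exp (x ω * Complex.I) ∂P := by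
    refine (LipschitzWith.of_dist_le_mul (K := 1) fun x y => ?_).continuous
    rw [dist_eq_norm, dist_eq_norm, NNReal.coe_one, one_mul,
      ← integral_sub (integrable_exp_mul_I (Lp.aestronglyMeasurable x))
        (integrable_exp_mul_I (Lp.aestronglyMeasurable y))]
    refine (norm_integral_le_integral_norm _).trans
      ((integral_mono_of_nonneg (Filter.Eventually.of_forall fun ω => norm_nonneg _) ?_
        (Filter.Eventually.of_forall fun ω => norm_exp_mul_I_sub_le _ _)).trans
        (integral_abs_sub_le_norm_sub x y))
    have := (Lp.memLp (x - y)).integrable (by norm_num : (1 : ENNReal) ≤ 2)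
    refine this.abs.congr ?_
    filter_upwards [Lp.coeFn_sub x y] with ω hω
    rw [hω]
    rfl
  exact isClosed_eq h1 (by fun_prop)

end HilbertProbability

-- Gaussian white noise and its closed span.

section Noise

variable {Ω : Type*} [MeasurableSpace Ω] {P : Measure Ω} {n : ℕ}
  {S : Matrix (Fin n) (Fin n) ℝ} {ε : ℤ → Ω → Fin n → ℝ}

theorem memLp_of_map_eq_multivariateGaussian {X : Ω → Fin n → ℝ} (hX : Measurable X)
    (hlaw : P.map (fun ω => WithLp.toLp 2 (X ω)) = multivariateGaussian 0 S) (i : Fin n) :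
    MemLp (fun ω => X ω i) 2 P := by
  have h1 : MemLp (fun x : EuclideanSpace ℝ (Fin n) => x i) 2 (multivariateGaussian 0 S) :=
    (IsGaussian.memLp_two_id
      (μ := multivariateGaussian (0 : EuclideanSpace ℝ (Fin n)) S)).eval_piLp i
  rw [← hlaw] at h1
  exact h1.comp_of_map (by fun_prop)

theorem integral_eq_zero_of_map_eq_multivariateGaussian {X : Ω → Fin n → ℝ} (hX : Measurable X)
    (hlaw : P.map (fun ω => WithLp.toLp 2 (X ω)) = multivariateGaussian 0 S) (i : Fin n) :
    ∫ ω, X ω i ∂P = 0 := by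
  have h1 : ∫ x : EuclideanSpace ℝ (Fin n), x i ∂(multivariateGaussian 0 S) = 0 := by
    have := ContinuousLinearMap.integral_comp_comm (EuclideanSpace.proj i : _ →L[ℝ] ℝ)
      (IsGaussian.integrable_id (μ := multivariateGaussian (0 : EuclideanSpace ℝ (Fin n)) S))
    simpa using this
  rw [← hlaw, integral_map (by fun_prop) (by fun_prop)] at h1
  exact h1

theorem covariance_of_map_eq_multivariateGaussian (hS : S.PosSemidef) {X : Ω → Fin n → ℝ}
    (hX : Measurable X)
    (hlaw : P.map (fun ω => WithLp.toLp 2 (X ω)) = multivariateGaussian 0 S) (i j : Fin n) :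
    cov[fun ω => X ω i, fun ω => X ω j; P] = S i j := by
  rw [← covariance_eval_multivariateGaussian (μ := 0) hS i j, ← hlaw,
    covariance_map (by fun_prop) (by fun_prop) (by fun_prop)]
  rfl

theorem integral_exp_of_map_eq_multivariateGaussian (hS : S.PosSemidef) {X : Ω → Fin n → ℝ}
    (hX : Measurable X)
    (hlaw : P.map (fun ω => WithLp.toLp 2 (X ω)) = multivariateGaussian 0 S) (c : Fin n → ℝ) :
    ∫ ω, Complex.exp (((∑ i, c i * X ω i : ℝ) : ℂ) * Complex.I) ∂P =
      Complex.exp (-(c ⬝ᵥ S *ᵥ c : ℝ) / 2) := by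
  have h1 := charFun_multivariateGaussian (μ := 0) hS (WithLp.toLp 2 c)
  rw [← hlaw, charFun_apply, integral_map (by fun_prop) (by fun_prop)] at h1
  simpa [PiLp.inner_apply, neg_div] using h1

theorem integral_exp_noise [IsProbabilityMeasure P] (hS : S.PosSemidef) (hm : ∀ t, Measurable (ε t))
    (hind : iIndepFun ε P)
    (hlaw : ∀ t, P.map (fun ω => WithLp.toLp 2 (ε t ω)) = multivariateGaussian 0 S)
    (s : Finset ℤ) (c : ℤ → Fin n → ℝ) :
    ∫ ω, Complex.exp (((∑ t ∈ s, ∑ i, c t i * ε t ω i : ℝ) : ℂ) * Complex.I) ∂P =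
      Complex.exp (-(∑ t ∈ s, c t ⬝ᵥ S *ᵥ c t : ℝ) / 2) := by
  have hcm : ∀ t, Measurable fun ω => ∑ i, c t i * ε t ω i := fun t => by
    have := hm t
    fun_prop
  have h1 : iIndepFun (fun t ω => ∑ i, c t i * ε t ω i) P :=
    hind.comp (fun t x => ∑ i, c t i * x i) fun t => by fun_prop
  have h2 := (h1.restrict s).charFun_map_fun_finsetSum_eq_prod (s := s)
    (X := fun t ω => ∑ i, c t i * ε t ω i) fun t _ => (hcm t).aemeasurable
  have h3 := congrFun h2 1
  rw [Finset.prod_apply, charFun_apply_real,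
    integral_map (Finset.measurable_sum _ fun t _ => hcm t).aemeasurable
      (Measurable.aestronglyMeasurable (by fun_prop))] at h3
  simp only [Complex.ofReal_one, one_mul] at h3
  rw [h3, Complex.ofReal_sum, ← Finset.sum_neg_distrib, Finset.sum_div, Complex.exp_sum]
  refine Finset.prod_congr rfl fun t _ => ?_
  rw [charFun_apply_real, integral_map (hcm t).aemeasurable
    (Measurable.aestronglyMeasurable (by fun_prop))]
  simp only [Complex.ofReal_one, one_mul]
  rw [integral_exp_of_map_eq_multivariateGaussian hS (hm t) (hlaw t)]

/-- The noise as a family of vectors of `L²`. -/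
def noiseClass (hm : ∀ t, Measurable (ε t))
    (hlaw : ∀ t, P.map (fun ω => WithLp.toLp 2 (ε t ω)) = multivariateGaussian 0 S)
    (t : ℤ) (i : Fin n) : Lp ℝ 2 P :=
  (memLp_of_map_eq_multivariateGaussian (hm t) (hlaw t) i).toLp (fun ω => ε t ω i)

theorem gram_noiseClass [IsProbabilityMeasure P] (hS : S.PosSemidef) (hm : ∀ t, Measurable (ε t))
    (hind : iIndepFun ε P)
    (hlaw : ∀ t, P.map (fun ω => WithLp.toLp 2 (ε t ω)) = multivariateGaussian 0 S) (s t : ℤ) :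
    gram (noiseClass hm hlaw s) (noiseClass hm hlaw t) = if s = t then S else 0 := by
  ext i j
  rw [gram_apply, noiseClass, noiseClass, inner_toLp_eq_covariance _ _
    (integral_eq_zero_of_map_eq_multivariateGaussian (hm s) (hlaw s) i)]
  split_ifs with h
  · subst h
    exact covariance_of_map_eq_multivariateGaussian hS (hm s) (hlaw s) i j
  · exact IndepFun.covariance_eq_zero (X := fun ω => ε s ω i) (Y := fun ω => ε t ω j)
      ((hind.indepFun h).comp (φ := fun x : Fin n → ℝ => x i)
        (ψ := fun x : Fin n → ℝ => x j) (by fun_prop) (by fun_prop))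
      (memLp_of_map_eq_multivariateGaussian (hm s) (hlaw s) i)
      (memLp_of_map_eq_multivariateGaussian (hm t) (hlaw t) j)

/-- By closedness finite combinations suffice, and for them independence over time factors the
characteristic function. Its value at 1 is enough information because the set treated is a subspace:
scaling recovers the other values. -/
theorem topologicalClosure_span_noiseClass_subset [IsProbabilityMeasure P]
    (hS : S.PosSemidef)
    (hm : ∀ t, Measurable (ε t)) (hind : iIndepFun ε P)
    (hlaw : ∀ t, P.map (fun ω => WithLp.toLp 2 (ε t ω)) = multivariateGaussian 0 S) :
    ((Submodule.span ℝ (Set.range fun k : ℤ × Fin n =>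
      noiseClass hm hlaw k.1 k.2)).topologicalClosure : Set (Lp ℝ 2 P)) ⊆ gaussianSet P := by
  rw [Submodule.topologicalClosure_coe]
  refine closure_minimal (fun x hx => ?_) isClosed_gaussianSet
  obtain ⟨c, rfl⟩ := Finsupp.mem_span_range_iff_exists_finsupp.1 hx
  -- Coordinates are regrouped by time: only the vectors at different times are independent.
  set s := c.support.image Prod.fst
  have hx2 : (c.sum fun k a => a • noiseClass hm hlaw k.1 k.2) =
      ∑ t ∈ s, ∑ i, c (t, i) • noiseClass hm hlaw t i := by
    rw [← Finset.sum_product', Finsupp.sum]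
    refine Finset.sum_subset (fun k hk => ?_) fun k _ hk => ?_
    · simp only [Finset.mem_product, Finset.mem_univ, and_true]
      exact Finset.mem_image_of_mem _ hk
    · rw [Finsupp.notMem_support_iff.1 hk, zero_smul]
  rw [hx2]
  have hnorm : ‖∑ t ∈ s, ∑ i, c (t, i) • noiseClass hm hlaw t i‖ ^ 2 =
      ∑ t ∈ s, (fun i => c (t, i)) ⬝ᵥ S *ᵥ (fun i => c (t, i)) := by
    rw [← real_inner_self_eq_norm_sq, sum_inner]
    refine Finset.sum_congr rfl fun t ht => ?_
    rw [inner_sum]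
    have h1 : ∀ u, inner ℝ (∑ i, c (t, i) • noiseClass hm hlaw t i)
        (∑ i, c (u, i) • noiseClass hm hlaw u i) = (fun i => c (t, i)) ⬝ᵥ
          (gram (noiseClass hm hlaw t) (noiseClass hm hlaw u)) *ᵥ (fun i => c (u, i)) := by
      intro u
      simp only [sum_inner, inner_sum, real_inner_smul_left, real_inner_smul_right, dotProduct,
        Matrix.mulVec, gram_apply, Finset.mul_sum]
      rw [Finset.sum_comm]
      exact Finset.sum_congr rfl fun i _ => Finset.sum_congr rfl fun j _ => by ring
    rw [Finset.sum_eq_single_of_mem t ht]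
    · rw [h1, gram_noiseClass hS hm hind hlaw, if_pos rfl]
    · intro u _ hu
      rw [h1, gram_noiseClass hS hm hind hlaw, if_neg hu.symm, Matrix.zero_mulVec,
        dotProduct_zero]
  have hfun : (∑ t ∈ s, ∑ i, c (t, i) • noiseClass hm hlaw t i : Lp ℝ 2 P) =ᵐ[P]
      fun ω => ∑ t ∈ s, ∑ i, c (t, i) * ε t ω i := by
    have h1 : (∑ t ∈ s, ∑ i, c (t, i) • noiseClass hm hlaw t i) =
        sqClass P (∑ t ∈ s, ∑ i, c (t, i) • ⟨fun ω => ε t ω i,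
          memLp_of_map_eq_multivariateGaussian (hm t) (hlaw t) i⟩) := by
      simp only [map_sum, map_smul, sqClass_mk]
      rfl
    rw [h1]
    refine (coeFn_sqClass _).trans (Filter.Eventually.of_forall fun ω => ?_)
    simp [Finset.sum_apply]
  rw [gaussianSet, Set.mem_ofPred_eq, hnorm,
    ← integral_exp_noise hS hm hind hlaw s fun t i => c (t, i)]
  refine integral_congr_ae ?_
  filter_upwards [hfun] with ω hω
  rw [hω]

end Noise

-- The observed process as a Hilbert space solution.

namespace VARMAParam.IsVARMA

variable {Ω : Type*} [MeasurableSpace Ω] {P : Measure Ω} [IsProbabilityMeasure P] {n p q : ℕ}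
  {ξ : VARMAParam n p q} {Y : ℤ → Ω → Fin n → ℝ}

/-- The process as a family of vectors of `L²`. -/
def obsClass (hY : ξ.IsVARMA P Y) (t : ℤ) (i : Fin n) : Lp ℝ 2 P :=
  (hY.2.1 t i).toLp (fun ω => Y t ω i)

theorem gram_obsClass (hY : ξ.IsVARMA P Y) (s t : ℤ) (i j : Fin n) :
    gram (hY.obsClass s) (hY.obsClass t) i j = cov[fun ω => Y s ω i, fun ω => Y t ω j; P] :=
  inner_toLp_eq_covariance _ _ (hY.2.2.1 s i)

theorem exists_isHilbertVARMA (hY : ξ.IsVARMA P Y) (hpos : ξ.covEps.PosDef) :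
    ∃ e : ℤ → Fin n → Lp ℝ 2 P, ξ.IsHilbertVARMA hY.obsClass e ∧
      ((Submodule.span ℝ (Set.range fun k : ℤ × Fin n => e k.1 k.2)).topologicalClosure :
        Set (Lp ℝ 2 P)) ⊆ gaussianSet P := by
  have hcov := hY.2.2.2.1
  obtain ⟨ε, hm, hind, hlaw, heq⟩ := hY.2.2.2.2
  refine ⟨noiseClass hm hlaw, ⟨gram_noiseClass hpos.posSemidef hm hind hlaw, ?_, fun t => ?_⟩,
    topologicalClosure_span_noiseClass_subset hpos.posSemidef hm hind hlaw⟩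
  -- Weak stationarity at lag 0 makes the norms independent of `t`, which gives boundedness.
  · refine ⟨∑ i, ‖hY.obsClass 0 i‖, fun t i => ?_⟩
    have h1 : ‖hY.obsClass t i‖ ^ 2 = ‖hY.obsClass 0 i‖ ^ 2 := by
      rw [← real_inner_self_eq_norm_sq, ← real_inner_self_eq_norm_sq, ← gram_apply, ← gram_apply,
        gram_obsClass, gram_obsClass]
      simpa using hcov 0 t i i
    rw [(sq_eq_sq₀ (norm_nonneg _) (norm_nonneg _)).1 h1]
    exact Finset.single_le_sum (f := fun i => ‖hY.obsClass 0 i‖) (fun i _ => norm_nonneg _)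
      (Finset.mem_univ i)
  · funext a
    have hYm : ∀ t i, (fun ω => Y t ω i) ∈ sqIntegrable P := hY.2.1
    have hεm : ∀ t i, (fun ω => ε t ω i) ∈ sqIntegrable P := fun t i =>
      memLp_of_map_eq_multivariateGaussian (hm t) (hlaw t) i
    have key : sqClass P (⟨_, hYm t a⟩ - ∑ i : Fin p, ∑ b, ξ.Φ i a b •
          ⟨_, hYm (t - ((i : ℤ) + 1)) b⟩) =
        sqClass P (⟨_, hεm t a⟩ + ∑ i : Fin q, ∑ b, ξ.Θ i a b •
          ⟨_, hεm (t - ((i : ℤ) + 1)) b⟩) := by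
      refine sqClass_congr ?_
      filter_upwards [heq t] with ω hω
      have := congrFun hω a
      simpa [Finset.sum_apply, Matrix.mulVec, dotProduct] using this
    simp only [map_sub, map_add, map_sum, map_smul] at key
    simp only [Pi.sub_apply, Pi.add_apply, Finset.sum_apply, Matrix.Module.smul_apply]
    exact key

end VARMAParam.IsVARMA

-- The transformation and the innovations as linear functionals of the sample.

/-- The coordinate functionals of a sample. -/
def obsDual {n : ℕ} (T : ℕ) (t : ℤ) (i : Fin n) : (Fin T → Fin n → ℝ) →ₗ[ℝ] ℝ :=
  if h : 1 ≤ t ∧ t ≤ T then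
    (LinearMap.proj i : (Fin n → ℝ) →ₗ[ℝ] ℝ) ∘ₗ
      (LinearMap.proj (⟨(t - 1).toNat, by omega⟩ : Fin T) : (Fin T → Fin n → ℝ) →ₗ[ℝ] Fin n → ℝ)
  else 0

theorem obsDual_apply {n T : ℕ} (t : ℕ) (i : Fin n) (y : Fin T → Fin n → ℝ) :
    obsDual T t i y = obsAt y t i := by
  rw [obsDual, obsAt]
  by_cases h : 1 ≤ t ∧ t ≤ T
  · rw [dif_pos h, dif_pos (by omega)]
    simp only [LinearMap.comp_apply, LinearMap.proj_apply]
    congr 2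
    omega
  · rw [dif_neg h, dif_neg (by omega)]
    rfl

theorem obsAt_succ {n T : ℕ} (y : Fin T → Fin n → ℝ) (k : Fin T) : obsAt y (k + 1) = y k := by
  rw [obsAt, dif_pos (by omega)]
  rfl

theorem dual_eq_sum {ι κ : Type*} [Fintype ι] [DecidableEq ι] [Fintype κ] [DecidableEq κ]
    (f : (ι → κ → ℝ) →ₗ[ℝ] ℝ) (y : ι → κ → ℝ) :
    f y = ∑ k, ∑ i, f (Pi.single k (Pi.single i 1)) * y k i := by
  have h1 : y = ∑ k, ∑ i, y k i • (Pi.single k (Pi.single i 1) : ι → κ → ℝ) := by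
    funext k i
    simp only [Finset.sum_apply, Pi.smul_apply, smul_eq_mul]
    rw [Finset.sum_eq_single k, Finset.sum_eq_single i]
    · simp
    · intro j _ hj
      simp [hj.symm]
    · simp
    · intro m _ hm
      refine Finset.sum_eq_zero fun j _ => ?_
      simp [hm.symm]
    · simp
  conv_lhs => rw [h1]
  simp only [map_sum, map_smul, smul_eq_mul]
  exact Finset.sum_congr rfl fun k _ => Finset.sum_congr rfl fun i _ => mul_comm _ _

namespace VARMAParam

variable {n p q T : ℕ} (ξ : VARMAParam n p q)

/-- Agreement at times 1 to T suffices: leads are taken only when `t + max p q ≤ T`, so they never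
leave the sample. -/
theorem map_transformed {M M' : Type*} [AddCommGroup M] [Module ℝ M] [AddCommGroup M']
    [Module ℝ M'] (φ : M →ₗ[ℝ] M') (y : ℤ → Fin n → M) (y' : ℤ → Fin n → M') {t : ℕ} (ht : 1 ≤ t)
    (htT : t ≤ T) (h : ∀ s : ℤ, 1 ≤ s → s ≤ T → ∀ i, φ (y s i) = y' s i) (i : Fin n) :
    φ (ξ.transformed T y t i) = ξ.transformed T y' t i := by
  rw [transformed, transformed]
  split_ifs with hl
  · simp only [forward, Pi.sub_apply, Finset.sum_apply, Matrix.Module.smul_apply, map_sub, map_sum,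
      map_smul]
    rw [h t (by omega) (by omega)]
    congr 1
    refine Finset.sum_congr rfl fun k _ => Finset.sum_congr rfl fun j _ => ?_
    have := le_max_left p q
    rw [h _ (by omega) (by omega)]
  · exact h t (by omega) (by omega) i

theorem transformed_obsDual_apply (y : Fin T → Fin n → ℝ) (t : ℕ) (i : Fin n) :
    ξ.transformed T (obsDual T) t i y = ξ.forwardW y t i := by
  rw [transformed, forwardW]
  split_ifs with hl
  · simp only [forward, Pi.sub_apply, Finset.sum_apply, Matrix.Module.smul_apply,
      LinearMap.sub_apply, LinearMap.sum_apply, LinearMap.smul_apply, obsDual_apply,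
      Matrix.mulVec, dotProduct, smul_eq_mul]
    congr 1
    refine Finset.sum_congr rfl fun k _ => Finset.sum_congr rfl fun j _ => ?_
    rw [← obsDual_apply]
    push_cast
    rfl
  · exact obsDual_apply t i y

theorem innovW_succ (y : Fin T → Fin n → ℝ) (t : ℕ) : ξ.innovW y (t + 1) =
    ξ.forwardW y (t + 1) -
      ∑ k ∈ Finset.range t, innovCoef (ξ.gammaW T) t (t - k) *ᵥ ξ.innovW y (k + 1) := by
  rw [innovW, predW]
  simp only [Nat.add_sub_cancel, coefW]
  rw [← Finset.sum_range (fun j => innovCoef (ξ.gammaW T) t (j + 1) *ᵥ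
    (ξ.forwardW y (t + 1 - (j + 1)) - ξ.predW y (t + 1 - (j + 1)))), ← Finset.sum_range_reflect]
  congr 1
  refine Finset.sum_congr rfl fun k hk => ?_
  have hk' : k < t := by simpa using hk
  rw [innovW]
  have e1 : t + 1 - 1 - 1 - k + 1 = t - k := by omega
  have e2 : t + 1 - (t - k) = k + 1 := by omega
  rw [e1, e2]

/-- The innovations as linear functionals of the sample. -/
def innovDual (T t : ℕ) (i : Fin n) : (Fin T → Fin n → ℝ) →ₗ[ℝ] ℝ :=
  innovSeq (ξ.gammaW T) (ξ.transformed T (obsDual T)) t i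

theorem innovDual_apply (y : Fin T → Fin n → ℝ) {t : ℕ} (ht : 1 ≤ t) (i : Fin n) :
    ξ.innovDual T t i y = ξ.innovW y t i := by
  induction t using Nat.strong_induction_on generalizing i with
  | _ t ih =>
    obtain ⟨t, rfl⟩ := Nat.exists_eq_add_of_le' ht
    rw [innovDual, innovSeq_succ, innovW_succ]
    simp only [Pi.sub_apply, Finset.sum_apply, Matrix.Module.smul_apply,
      LinearMap.sub_apply, LinearMap.sum_apply, LinearMap.smul_apply, transformed_obsDual_apply,
      Matrix.mulVec, dotProduct, smul_eq_mul]
    congr 1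
    refine Finset.sum_congr rfl fun k hk => Finset.sum_congr rfl fun j _ => ?_
    have hk' : k < t := by simpa using hk
    rw [← ih (k + 1) (by omega) (by omega)]
    rfl

/-- The forward transformation as a linear map. -/
def forwardMap (T : ℕ) : (Fin T → Fin n → ℝ) →ₗ[ℝ] (Fin T → Fin n → ℝ) :=
  LinearMap.pi fun k => LinearMap.pi fun i => ξ.transformed T (obsDual T) ((k : ℕ) + 1) i

theorem forwardMap_apply (y : Fin T → Fin n → ℝ) (k : Fin T) :
    ξ.forwardMap T y k = ξ.forwardW y (k + 1) := by
  funext i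
  exact ξ.transformed_obsDual_apply y (k + 1) i

/-- The map from a sample to its innovations. -/
def innovMap (T : ℕ) : (Fin T → Fin n → ℝ) →ₗ[ℝ] (Fin T → Fin n → ℝ) :=
  LinearMap.pi fun k => LinearMap.pi fun i => ξ.innovDual T ((k : ℕ) + 1) i

theorem innovMap_apply (y : Fin T → Fin n → ℝ) (k : Fin T) :
    ξ.innovMap T y k = ξ.innovW y (k + 1) := by
  funext i
  exact ξ.innovDual_apply y (by omega) i

theorem det_forwardMap : LinearMap.det (ξ.forwardMap T) = 1 := by
  -- The forward transformation involves later times, so the rank decreases with time.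
  refine LinearMap.det_eq_one_of_unitriangular (r := fun k : Fin T => T - (k : ℕ))
    fun y k hk => ?_
  rw [forwardMap_apply, forwardW]
  split_ifs with h
  · rw [obsAt_succ, Finset.sum_eq_zero, sub_zero]
    intro i _
    have := le_max_left p q
    have h1 : obsAt y ((k : ℕ) + 1 + ((i : ℕ) + 1)) = 0 := by
      rw [show (k : ℕ) + 1 + ((i : ℕ) + 1) = (k : ℕ) + ((i : ℕ) + 1) + 1 by omega]
      exact (obsAt_succ y ⟨(k : ℕ) + ((i : ℕ) + 1), by omega⟩).trans
        (hk ⟨(k : ℕ) + ((i : ℕ) + 1), by omega⟩ (by simp only; omega))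
    rw [h1, Matrix.mulVec_zero]
  · exact obsAt_succ y k

theorem innovW_eq_forwardW (y : Fin T → Fin n → ℝ) (t : ℕ)
    (h : ∀ s, s < t → ξ.forwardW y (s + 1) = 0) : ξ.innovW y (t + 1) = ξ.forwardW y (t + 1) := by
  induction t using Nat.strong_induction_on with
  | _ t ih =>
    rw [innovW_succ, Finset.sum_eq_zero, sub_zero]
    intro k hk
    have hk' : k < t := by simpa using hk
    rw [ih k hk' fun s hs => h s (by omega), h k hk', Matrix.mulVec_zero]

/-- W is triangular in the sample from the future and the innovations are triangular in W from the
past. The composite need not be triangular, so the two factors are treated separately. -/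
theorem det_innovMap : LinearMap.det (ξ.innovMap T) = 1 := by
  have hF : LinearMap.det (ξ.forwardMap T) ≠ 0 := by rw [det_forwardMap]; exact one_ne_zero
  set e := LinearMap.equivOfDetNeZero (ξ.forwardMap T) hF
  have he : ∀ y, ξ.forwardMap T y = e y := fun y => rfl
  have h1 : LinearMap.det (ξ.innovMap T ∘ₗ (e.symm : _ →ₗ[ℝ] (Fin T → Fin n → ℝ))) = 1 := by
    refine LinearMap.det_eq_one_of_unitriangular (r := fun k : Fin T => (k : ℕ)) fun y k hk => ?_
    rw [LinearMap.comp_apply, innovMap_apply]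
    have h2 : ∀ s : Fin T, ξ.forwardW (e.symm y) (s + 1) = y s := by
      intro s
      rw [← forwardMap_apply, he, e.apply_symm_apply]
    rw [← h2 k]
    refine ξ.innovW_eq_forwardW _ _ fun s hs => ?_
    have h3 := h2 ⟨s, by omega⟩
    rw [hk ⟨s, by omega⟩ hs] at h3
    exact h3
  have h2 : ξ.innovMap T =
      (ξ.innovMap T ∘ₗ (e.symm : _ →ₗ[ℝ] (Fin T → Fin n → ℝ))) ∘ₗ ξ.forwardMap T := by
    refine LinearMap.ext fun y => ?_
    simp only [LinearMap.comp_apply, he]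
    congr 1
    exact (e.symm_apply_apply y).symm
  rw [h2, LinearMap.det_comp, h1, det_forwardMap, one_mul]

theorem sum_smul_innovDual_ne_zero {t : ℕ} (ht : 1 ≤ t) (htT : t ≤ T) {v : Fin n → ℝ}
    (hv : v ≠ 0) : ∑ i, v i • ξ.innovDual T t i ≠ 0 := by
  intro h0
  have hdet : LinearMap.det (ξ.innovMap T) ≠ 0 := by rw [det_innovMap]; exact one_ne_zero
  set e := LinearMap.equivOfDetNeZero (ξ.innovMap T) hdet
  have he : ∀ y, ξ.innovMap T y = e y := fun y => rfl
  -- At the sample whose innovations all equal `v` the functional takes the value v · v.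
  have h1 := LinearMap.congr_fun h0 (e.symm fun _ => v)
  have h2 : ∀ i, ξ.innovDual T t i (e.symm fun _ => v) = v i := by
    intro i
    have h3 : ξ.innovMap T (e.symm fun _ => v) ⟨t - 1, by omega⟩ = v := by
      rw [he, e.apply_symm_apply]
    rw [innovMap_apply] at h3
    rw [innovDual_apply _ _ ht, ← congrFun h3 i]
    congr 2
    simp only
    omega
  simp only [LinearMap.sum_apply, LinearMap.smul_apply, h2, LinearMap.zero_apply,
    smul_eq_mul] at h1
  exact hv (dotProduct_self_eq_zero.1 h1)

end VARMAParam

-- Gaussian laws of linear images of the sample.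

theorem measurable_dual {T n : ℕ} (f : (Fin T → Fin n → ℝ) →ₗ[ℝ] ℝ) : Measurable f :=
  f.continuous_of_finiteDimensional.measurable

namespace VARMAParam.IsVARMA

variable {Ω : Type*} [MeasurableSpace Ω] {P : Measure Ω} {n p q T : ℕ}
  {ξ : VARMAParam n p q} {Y : ℤ → Ω → Fin n → ℝ}

theorem measurable_sampleOf (hY : ξ.IsVARMA P Y) (T : ℕ) : Measurable (sampleOf T Y) :=
  measurable_pi_lambda _ fun _ => hY.1 _

theorem memLp_dual (hY : ξ.IsVARMA P Y) (f : (Fin T → Fin n → ℝ) →ₗ[ℝ] ℝ) :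
    MemLp (fun ω => f (sampleOf T Y ω)) 2 P := by
  rw [show (fun ω => f (sampleOf T Y ω)) = _ from funext fun ω => dual_eq_sum f _]
  exact memLp_finsetSum _ fun k _ => memLp_finsetSum _ fun i _ => (hY.2.1 _ i).const_mul _

/-- A linear functional of the sample as a vector of `L²`. -/
def sampleClass (hY : ξ.IsVARMA P Y) (T : ℕ) :
    ((Fin T → Fin n → ℝ) →ₗ[ℝ] ℝ) →ₗ[ℝ] Lp ℝ 2 P :=
  sqClass P ∘ₗ
    { toFun := fun f => ⟨fun ω => f (sampleOf T Y ω), hY.memLp_dual f⟩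
      map_add' := fun _ _ => rfl
      map_smul' := fun _ _ => rfl }

theorem coeFn_sampleClass (hY : ξ.IsVARMA P Y) (f : (Fin T → Fin n → ℝ) →ₗ[ℝ] ℝ) :
    hY.sampleClass T f =ᵐ[P] fun ω => f (sampleOf T Y ω) := coeFn_sqClass _

theorem sampleClass_obsDual (hY : ξ.IsVARMA P Y) {t : ℤ} (ht : 1 ≤ t) (htT : t ≤ T) (i : Fin n) :
    hY.sampleClass T (obsDual T t i) = hY.obsClass t i := by
  refine sqClass_congr (f := ⟨_, hY.memLp_dual _⟩) (g := ⟨_, hY.2.1 t i⟩)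
    (Filter.Eventually.of_forall fun ω => ?_)
  obtain ⟨m, rfl⟩ := Int.eq_ofNat_of_zero_le (by omega : 0 ≤ t)
  change obsDual T m i (sampleOf T Y ω) = Y m ω i
  rw [obsDual_apply, obsAt, dif_pos (by omega), sampleOf]
  congr 2
  simp only
  omega

theorem sampleClass_eq_sum (hY : ξ.IsVARMA P Y) (f : (Fin T → Fin n → ℝ) →ₗ[ℝ] ℝ) :
    hY.sampleClass T f = ∑ k : Fin T, ∑ i,
      f (Pi.single k (Pi.single i 1)) • hY.obsClass ((k : ℤ) + 1) i := by
  have h1 : f = ∑ k : Fin T, ∑ i, f (Pi.single k (Pi.single i 1)) •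
      obsDual T (((k : ℕ) + 1 : ℕ) : ℤ) i := by
    refine LinearMap.ext fun y => ?_
    simp only [LinearMap.sum_apply, LinearMap.smul_apply, obsDual_apply, obsAt_succ, smul_eq_mul]
    exact dual_eq_sum f y
  conv_lhs => rw [h1]
  simp only [map_sum, map_smul]
  refine Finset.sum_congr rfl fun k _ => Finset.sum_congr rfl fun i _ => ?_
  rw [hY.sampleClass_obsDual (by omega) (by omega)]
  push_cast
  rfl

theorem integral_dual [IsProbabilityMeasure P] (hY : ξ.IsVARMA P Y)
    (f : (Fin T → Fin n → ℝ) →ₗ[ℝ] ℝ) :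
    ∫ ω, f (sampleOf T Y ω) ∂P = 0 := by
  have hint : ∀ (k : Fin T) (i : Fin n), Integrable (fun ω => sampleOf T Y ω k i) P :=
    fun k i => (hY.2.1 _ i).integrable (by norm_num)
  rw [show (fun ω => f (sampleOf T Y ω)) = _ from funext fun ω => dual_eq_sum f _,
    integral_finsetSum _ fun k _ => integrable_finsetSum _ fun i _ => (hint k i).const_mul _]
  refine Finset.sum_eq_zero fun k _ => ?_
  rw [integral_finsetSum _ fun i _ => (hint k i).const_mul _]
  refine Finset.sum_eq_zero fun i _ => ?_
  rw [integral_const_mul, show ∫ ω, sampleOf T Y ω k i ∂P = 0 from hY.2.2.1 _ i, mul_zero]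

theorem inner_sampleClass [IsProbabilityMeasure P] (hY : ξ.IsVARMA P Y)
    (f g : (Fin T → Fin n → ℝ) →ₗ[ℝ] ℝ) :
    inner ℝ (hY.sampleClass T f) (hY.sampleClass T g) =
      cov[fun ω => f (sampleOf T Y ω), fun ω => g (sampleOf T Y ω); P] :=
  inner_toLp_eq_covariance (hY.memLp_dual f) (hY.memLp_dual g) (hY.integral_dual f)

theorem sampleClass_ne_zero (hY : ξ.IsVARMA P Y) {e : ℤ → Fin n → Lp ℝ 2 P}
    (h : ξ.IsHilbertVARMA hY.obsClass e)
    (hAR : ∀ z : ℂ, ‖z‖ ≤ 1 → (ξ.arPoly z).det ≠ 0) (hpos : ξ.covEps.PosDef)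
    {f : (Fin T → Fin n → ℝ) →ₗ[ℝ] ℝ} (hf : f ≠ 0) : hY.sampleClass T f ≠ 0 := by
  intro h0
  rw [sampleClass_eq_sum] at h0
  have hc := h.eq_zero_of_sum_smul_eq_zero hAR hpos
    (c := fun k i => f (Pi.single k (Pi.single i 1))) h0
  refine hf (LinearMap.ext fun y => ?_)
  rw [dual_eq_sum f]
  refine Finset.sum_eq_zero fun k _ => Finset.sum_eq_zero fun i _ => ?_
  rw [show f (Pi.single k (Pi.single i 1)) = 0 from congrFun (congrFun hc k) i, zero_mul]

/-- Every linear functional of the sample is centered Gaussian. -/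
theorem integral_exp_dual (hY : ξ.IsVARMA P Y) {e : ℤ → Fin n → Lp ℝ 2 P}
    (h : ξ.IsHilbertVARMA hY.obsClass e)
    (hsub : ((Submodule.span ℝ (Set.range fun k : ℤ × Fin n => e k.1 k.2)).topologicalClosure :
        Set (Lp ℝ 2 P)) ⊆ gaussianSet P)
    (hAR : ∀ z : ℂ, ‖z‖ ≤ 1 → (ξ.arPoly z).det ≠ 0) (f : (Fin T → Fin n → ℝ) →ₗ[ℝ] ℝ) :
    ∫ ω, Complex.exp (f (sampleOf T Y ω) * Complex.I) ∂P =
      Complex.exp (-(‖hY.sampleClass T f‖ ^ 2 : ℝ) / 2) := by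
  have hmem : hY.sampleClass T f ∈ gaussianSet P := by
    refine hsub ?_
    rw [sampleClass_eq_sum]
    exact Submodule.sum_mem _ fun k _ => Submodule.sum_mem _ fun i _ =>
      Submodule.smul_mem _ _ (h.mem_topologicalClosure hAR _ i)
  rw [gaussianSet, Set.mem_ofPred_eq] at hmem
  rw [← hmem]
  refine integral_congr_ae ?_
  filter_upwards [hY.coeFn_sampleClass f] with ω hω
  rw [hω]

/-- Uncorrelated linear images of the sample are independent. -/
theorem indepFun_of_inner_eq_zero [IsProbabilityMeasure P] (hY : ξ.IsVARMA P Y)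
    (hexp : ∀ f : (Fin T → Fin n → ℝ) →ₗ[ℝ] ℝ,
      ∫ ω, Complex.exp (f (sampleOf T Y ω) * Complex.I) ∂P =
        Complex.exp (-(‖hY.sampleClass T f‖ ^ 2 : ℝ) / 2))
    {ι κ : Type*} [Fintype ι] [Fintype κ]
    (A : (Fin T → Fin n → ℝ) →ₗ[ℝ] (ι → ℝ)) (B : (Fin T → Fin n → ℝ) →ₗ[ℝ] (κ → Fin n → ℝ))
    (hAB : ∀ i k j, inner ℝ (hY.sampleClass T (LinearMap.proj i ∘ₗ A))
      (hY.sampleClass T ((LinearMap.proj j : (Fin n → ℝ) →ₗ[ℝ] ℝ) ∘ₗ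
        (LinearMap.proj k : (κ → Fin n → ℝ) →ₗ[ℝ] Fin n → ℝ) ∘ₗ B)) = 0) :
    (fun ω => A (sampleOf T Y ω)) ⟂ᵢ[P] (fun ω => B (sampleOf T Y ω)) := by
  classical
  have hA : Measurable fun ω => A (sampleOf T Y ω) :=
    A.continuous_of_finiteDimensional.measurable.comp (hY.measurable_sampleOf T)
  have hB : Measurable fun ω => B (sampleOf T Y ω) :=
    B.continuous_of_finiteDimensional.measurable.comp (hY.measurable_sampleOf T)
  rw [indepFun_iff_charFunDual_prod hA.aemeasurable hB.aemeasurable]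
  intro L
  set f : (Fin T → Fin n → ℝ) →ₗ[ℝ] ℝ := (L.comp (.inl ℝ _ _)).toLinearMap ∘ₗ A with hf
  set g : (Fin T → Fin n → ℝ) →ₗ[ℝ] ℝ := (L.comp (.inr ℝ _ _)).toLinearMap ∘ₗ B with hg
  have h1 : charFunDual (P.map fun ω => (A (sampleOf T Y ω), B (sampleOf T Y ω))) L =
      Complex.exp (-(‖hY.sampleClass T (f + g)‖ ^ 2 : ℝ) / 2) := by
    rw [charFunDual_apply, integral_map (hA.prodMk hB).aemeasurable
      (Measurable.aestronglyMeasurable (by fun_prop)), ← hexp]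
    refine integral_congr_ae (Filter.Eventually.of_forall fun ω => ?_)
    simp only [hf, hg, LinearMap.add_apply, LinearMap.comp_apply,
      ContinuousLinearMap.coe_coe, ContinuousLinearMap.comp_apply, ← map_add]
    simp
  have h2 : charFunDual (P.map fun ω => A (sampleOf T Y ω)) (L.comp (.inl ℝ _ _)) =
      Complex.exp (-(‖hY.sampleClass T f‖ ^ 2 : ℝ) / 2) := by
    rw [charFunDual_apply, integral_map hA.aemeasurable
      (Measurable.aestronglyMeasurable (by fun_prop)), ← hexp]
    rfl
  have h3 : charFunDual (P.map fun ω => B (sampleOf T Y ω)) (L.comp (.inr ℝ _ _)) =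
      Complex.exp (-(‖hY.sampleClass T g‖ ^ 2 : ℝ) / 2) := by
    rw [charFunDual_apply, integral_map hB.aemeasurable
      (Measurable.aestronglyMeasurable (by fun_prop)), ← hexp]
    rfl
  have horth : inner ℝ (hY.sampleClass T f) (hY.sampleClass T g) = 0 := by
    have e1 : f = ∑ i, L (Pi.single i 1, 0) • ((LinearMap.proj i : (ι → ℝ) →ₗ[ℝ] ℝ) ∘ₗ A) := by
      refine LinearMap.ext fun y => ?_
      have := LinearMap.pi_apply_eq_sum_univ (L.comp (.inl ℝ _ _)).toLinearMap (A y)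
      simp only [hf, LinearMap.comp_apply]
      rw [this]
      simp only [LinearMap.sum_apply, LinearMap.smul_apply, LinearMap.comp_apply,
        LinearMap.proj_apply, smul_eq_mul]
      refine Finset.sum_congr rfl fun i _ => ?_
      rw [mul_comm, show (fun j => if i = j then (1 : ℝ) else 0) = Pi.single i 1 by
        funext j
        simp [Pi.single_apply, eq_comm]]
      rfl
    have e2 : g = ∑ k, ∑ j, L (0, Pi.single k (Pi.single j 1)) •
        ((LinearMap.proj j : (Fin n → ℝ) →ₗ[ℝ] ℝ) ∘ₗ
        (LinearMap.proj k : (κ → Fin n → ℝ) →ₗ[ℝ] Fin n → ℝ) ∘ₗ B) := by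
      refine LinearMap.ext fun y => ?_
      have := dual_eq_sum (L.comp (.inr ℝ _ _)).toLinearMap (B y)
      simp only [hg, LinearMap.comp_apply]
      rw [this]
      simp only [LinearMap.sum_apply, LinearMap.smul_apply, LinearMap.comp_apply,
        LinearMap.proj_apply, smul_eq_mul]
      rfl
    rw [e1, e2]
    simp only [map_sum, map_smul, sum_inner, inner_sum, real_inner_smul_left,
      real_inner_smul_right, hAB, mul_zero, Finset.sum_const_zero]
  -- By Pythagoras the exponent is additive, so the joint characteristic function factors.
  rw [h1, h2, h3, ← Complex.exp_add, map_add, pow_two,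
    norm_add_sq_eq_norm_sq_add_norm_sq_real horth]
  congr 1
  push_cast
  ring

/-- Linear maps whitening the sample give a standard Gaussian vector. -/
theorem map_eq_pi_gaussianReal [IsProbabilityMeasure P] (hY : ξ.IsVARMA P Y)
    (hexp : ∀ f : (Fin T → Fin n → ℝ) →ₗ[ℝ] ℝ,
      ∫ ω, Complex.exp (f (sampleOf T Y ω) * Complex.I) ∂P =
        Complex.exp (-(‖hY.sampleClass T f‖ ^ 2 : ℝ) / 2))
    (L : (Fin T → Fin n → ℝ) →ₗ[ℝ] (Fin T → Fin n → ℝ))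
    (hL : ∀ k m : Fin T, gram
      (fun i => hY.sampleClass T ((LinearMap.proj i : (Fin n → ℝ) →ₗ[ℝ] ℝ) ∘ₗ
        (LinearMap.proj k : (Fin T → Fin n → ℝ) →ₗ[ℝ] Fin n → ℝ) ∘ₗ L))
      (fun i => hY.sampleClass T ((LinearMap.proj i : (Fin n → ℝ) →ₗ[ℝ] ℝ) ∘ₗ
        (LinearMap.proj m : (Fin T → Fin n → ℝ) →ₗ[ℝ] Fin n → ℝ) ∘ₗ L)) =
        if k = m then 1 else 0) :
    P.map (fun ω => L (sampleOf T Y ω)) =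
      Measure.pi fun _ : Fin T => Measure.pi fun _ : Fin n => gaussianReal 0 1 := by
  have hLm : Measurable fun ω => L (sampleOf T Y ω) :=
    L.continuous_of_finiteDimensional.measurable.comp (hY.measurable_sampleOf T)
  have : IsProbabilityMeasure (P.map fun ω => L (sampleOf T Y ω)) :=
    Measure.isProbabilityMeasure_map hLm.aemeasurable
  refine Measure.ext_of_charFunDual ?_
  funext F
  set c : Fin T → Fin n → ℝ := fun k i => F (Pi.single k (Pi.single i 1)) with hc
  have h1 : charFunDual (P.map fun ω => L (sampleOf T Y ω)) F =
      Complex.exp (-(‖hY.sampleClass T (F.toLinearMap ∘ₗ L)‖ ^ 2 : ℝ) / 2) := by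
    rw [charFunDual_apply, integral_map hLm.aemeasurable
      (Measurable.aestronglyMeasurable (by fun_prop)), ← hexp]
    rfl
  have e2 : F.toLinearMap ∘ₗ L = ∑ k, ∑ j, c k j •
      ((LinearMap.proj j : (Fin n → ℝ) →ₗ[ℝ] ℝ) ∘ₗ
      (LinearMap.proj k : (Fin T → Fin n → ℝ) →ₗ[ℝ] Fin n → ℝ) ∘ₗ L) := by
    refine LinearMap.ext fun y => ?_
    have := dual_eq_sum F.toLinearMap (L y)
    simp only [LinearMap.comp_apply]
    rw [this]
    simp only [LinearMap.sum_apply, LinearMap.smul_apply, LinearMap.comp_apply,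
      LinearMap.proj_apply, smul_eq_mul]
    rfl
  have hin : ∀ k j m i, inner ℝ (hY.sampleClass T ((LinearMap.proj j : (Fin n → ℝ) →ₗ[ℝ] ℝ) ∘ₗ
        (LinearMap.proj k : (Fin T → Fin n → ℝ) →ₗ[ℝ] Fin n → ℝ) ∘ₗ L))
      (hY.sampleClass T ((LinearMap.proj i : (Fin n → ℝ) →ₗ[ℝ] ℝ) ∘ₗ
        (LinearMap.proj m : (Fin T → Fin n → ℝ) →ₗ[ℝ] Fin n → ℝ) ∘ₗ L)) =
      if k = m then (if j = i then 1 else 0) else 0 := by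
    intro k j m i
    have hkm := hL k m
    by_cases h : k = m
    · rw [if_pos h] at hkm ⊢
      exact (congrFun (congrFun hkm j) i).trans Matrix.one_apply
    · rw [if_neg h] at hkm ⊢
      exact congrFun (congrFun hkm j) i
  have hn : ‖hY.sampleClass T (F.toLinearMap ∘ₗ L)‖ ^ 2 = ∑ k, ∑ j, c k j ^ 2 := by
    rw [← real_inner_self_eq_norm_sq, e2]
    simp only [map_sum, map_smul, sum_inner, inner_sum, real_inner_smul_left,
      real_inner_smul_right, hin]
    simp [pow_two]
  have hr : charFunDual (Measure.pi fun _ : Fin T => Measure.pi fun _ : Fin n => gaussianReal 0 1) F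
      = Complex.exp (-((∑ k, ∑ j, c k j ^ 2 : ℝ) : ℂ) / 2) := by
    rw [charFunDual_pi, Complex.ofReal_sum, ← Finset.sum_neg_distrib, Finset.sum_div,
      Complex.exp_sum]
    refine Finset.prod_congr rfl fun k _ => ?_
    rw [charFunDual_pi, Complex.ofReal_sum, ← Finset.sum_neg_distrib, Finset.sum_div,
      Complex.exp_sum]
    refine Finset.prod_congr rfl fun j _ => ?_
    have h4 := charFun_gaussianReal (μ := 0) (v := 1) (c k j)
    rw [charFun_apply_real] at h4
    rw [charFunDual_apply]
    have h5 : ∀ v : ℝ, ((F.comp (.single ℝ (fun _ : Fin T => Fin n → ℝ) k)).comp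
        (.single ℝ (fun _ : Fin n => ℝ) j)) v = c k j * v := by
      intro v
      have : (Pi.single k (Pi.single j v) : Fin T → Fin n → ℝ) =
          v • Pi.single k (Pi.single j 1) := by
        rw [← Pi.single_smul, ← Pi.single_smul, smul_eq_mul, mul_one]
      simp only [ContinuousLinearMap.comp_apply, ContinuousLinearMap.single_apply, this, map_smul,
        smul_eq_mul, hc]
      ring
    simp only [h5, Complex.ofReal_mul]
    rw [h4]
    simp [neg_div]
  rw [h1, hn, hr]

end VARMAParam.IsVARMA

-- Whitening the innovations and the closed form of the density.

open scoped MatrixOrder Matrix.Norms.L2Operator in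
theorem Matrix.PosDef.exists_transpose_mul_self_eq_inv {m : Type*} [Fintype m] [DecidableEq m]
    {A : Matrix m m ℝ} (hA : A.PosDef) : ∃ R : Matrix m m ℝ, Rᵀ * R = A⁻¹ := by
  obtain ⟨R, hR⟩ := CStarAlgebra.nonneg_iff_eq_star_mul_self.1 hA.inv.posSemidef.nonneg
  exact ⟨R, by rw [hR, Matrix.star_eq_conjTranspose,
    Matrix.conjTranspose_eq_transpose_of_trivial]⟩

theorem Matrix.measurable_mulVec {n : ℕ} (A : Matrix (Fin n) (Fin n) ℝ) :
    Measurable fun v : Fin n → ℝ => A *ᵥ v :=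
  (Matrix.mulVecLin A).continuous_of_finiteDimensional.measurable

theorem Finset.prod_Icc_one_eq_prod_fin {M : Type*} [CommMonoid M] (T : ℕ) (f : ℕ → M) :
    ∏ t ∈ Finset.Icc 1 T, f t = ∏ k : Fin T, f (k + 1) := by
  rw [← Finset.prod_range (fun k => f (k + 1)), Finset.range_eq_Ico, Finset.prod_Ico_add' f 0 T 1]
  rfl

theorem Finset.sum_Icc_one_eq_sum_fin {M : Type*} [AddCommMonoid M] (T : ℕ) (f : ℕ → M) :
    ∑ t ∈ Finset.Icc 1 T, f t = ∑ k : Fin T, f (k + 1) := by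
  rw [← Finset.sum_range (fun k => f (k + 1)), Finset.range_eq_Ico, Finset.sum_Ico_add' f 0 T 1]
  rfl

/-- The product standard Gaussian density in closed form. -/
theorem prod_prod_gaussianPDFReal {n T : ℕ} (z : Fin T → Fin n → ℝ) :
    ∏ k, ∏ i, gaussianPDFReal 0 1 (z k i) = gZero z * Real.exp (-(∑ k, z k ⬝ᵥ z k) / 2) := by
  have h2pi : (0 : ℝ) ≤ 2 * Real.pi := by positivity
  have h1 : ∀ x : ℝ, gaussianPDFReal 0 1 x = (2 * Real.pi) ^ (-(1 / 2) : ℝ) *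
      Real.exp (-(x * x) / 2) := by
    intro x
    rw [gaussianPDFReal, Real.rpow_neg h2pi, ← Real.sqrt_eq_rpow]
    simp [pow_two]
  simp only [h1, Finset.prod_mul_distrib, Finset.prod_const, Finset.card_univ, Fintype.card_fin,
    ← Real.exp_sum]
  congr 1
  · rw [gZero, ← pow_mul, ← Real.rpow_mul_natCast h2pi]
    congr 1
    push_cast
    ring
  · congr 1
    rw [← Finset.sum_neg_distrib, Finset.sum_div]
    refine Finset.sum_congr rfl fun k _ => ?_
    rw [dotProduct, ← Finset.sum_neg_distrib, Finset.sum_div]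

namespace VARMAParam

variable {n p q T : ℕ} (ξ : VARMAParam n p q)

theorem measurable_forwardW (t : ℕ) :
    Measurable fun y : Fin T → Fin n → ℝ => ξ.forwardW y t := by
  refine measurable_pi_lambda _ fun i => ?_
  simp only [← transformed_obsDual_apply]
  exact measurable_dual _

theorem measurable_innovW {t : ℕ} (ht : 1 ≤ t) :
    Measurable fun y : Fin T → Fin n → ℝ => ξ.innovW y t := by
  refine measurable_pi_lambda _ fun i => ?_
  simp only [← ξ.innovDual_apply _ ht]
  exact measurable_dual _

/-- Blockwise multiplication of the innovations by matrices. -/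
def whitenMap (T : ℕ) (R : ℕ → Matrix (Fin n) (Fin n) ℝ) :
    (Fin T → Fin n → ℝ) →ₗ[ℝ] (Fin T → Fin n → ℝ) :=
  LinearMap.pi (fun k : Fin T => (Matrix.toLin' (R (k + 1))).comp (LinearMap.proj k)) ∘ₗ
    ξ.innovMap T

theorem whitenMap_apply (R : ℕ → Matrix (Fin n) (Fin n) ℝ) (y : Fin T → Fin n → ℝ) (k : Fin T) :
    ξ.whitenMap T R y k = R (k + 1) *ᵥ ξ.innovW y (k + 1) := by
  rw [whitenMap, LinearMap.comp_apply, LinearMap.pi_apply, LinearMap.comp_apply,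
    LinearMap.proj_apply, innovMap_apply, Matrix.toLin'_apply]

theorem det_whitenMap (R : ℕ → Matrix (Fin n) (Fin n) ℝ) :
    LinearMap.det (ξ.whitenMap T R) = ∏ k : Fin T, (R (k + 1)).det := by
  rw [whitenMap, LinearMap.det_comp, det_innovMap, mul_one, LinearMap.det_pi]
  simp only [LinearMap.det_toLin']

theorem quadForm_eq {R : ℕ → Matrix (Fin n) (Fin n) ℝ}
    (hR : ∀ t, 1 ≤ t → t ≤ T → (R t)ᵀ * R t = (ξ.sigmaW T t)⁻¹) (y : Fin T → Fin n → ℝ) :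
    ξ.quadForm y = ∑ k, ξ.whitenMap T R y k ⬝ᵥ ξ.whitenMap T R y k := by
  rw [quadForm, Finset.sum_Icc_one_eq_sum_fin]
  refine Finset.sum_congr rfl fun k _ => ?_
  rw [whitenMap_apply, ← hR _ (by omega) (by omega), ← Matrix.mulVec_mulVec,
    Matrix.dotProduct_mulVec, Matrix.vecMul_transpose]

/-- Since (det R_t)² = (det Σ_t)⁻¹ and the innovation map has determinant 1, the Jacobian is the
determinant factor of g₁; the sign of det R_t is unknown, hence the absolute value. -/
theorem abs_det_whitenMap {R : ℕ → Matrix (Fin n) (Fin n) ℝ}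
    (hpos : ∀ t, 1 ≤ t → t ≤ T → (ξ.sigmaW T t).PosDef)
    (hR : ∀ t, 1 ≤ t → t ≤ T → (R t)ᵀ * R t = (ξ.sigmaW T t)⁻¹) :
    |LinearMap.det (ξ.whitenMap T R)| =
      (∏ t ∈ Finset.Icc 1 T, (ξ.sigmaW T t).det) ^ (-(1 / 2) : ℝ) := by
  rw [det_whitenMap, Finset.prod_Icc_one_eq_prod_fin]
  have hb : 0 < ∏ k : Fin T, (ξ.sigmaW T (k + 1)).det :=
    Finset.prod_pos fun k _ => (hpos _ (by omega) (by omega)).det_pos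
  have hsq : (∏ k : Fin T, (R (k + 1)).det) ^ 2 = (∏ k : Fin T, (ξ.sigmaW T (k + 1)).det)⁻¹ := by
    rw [← Finset.prod_pow, ← Finset.prod_inv_distrib]
    refine Finset.prod_congr rfl fun k _ => ?_
    have := congrArg Matrix.det (hR (k + 1) (by omega) (by omega))
    rw [Matrix.det_mul, Matrix.det_transpose, Matrix.det_nonsing_inv, Ring.inverse_eq_inv'] at this
    rw [pow_two, this]
  rw [← Real.sqrt_sq_eq_abs, hsq, Real.rpow_neg hb.le, ← Real.sqrt_eq_rpow, Real.sqrt_inv]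

-- Prediction errors, likelihood and conditional expectation.

namespace IsVARMA

variable {ξ} {Ω : Type*} [MeasurableSpace Ω] {P : Measure Ω}
  {Y : ℤ → Ω → Fin n → ℝ} {e : ℤ → Fin n → Lp ℝ 2 P}

theorem sampleClass_innovDual (hY : ξ.IsVARMA P Y) (t : ℕ) (i : Fin n) :
    hY.sampleClass T (ξ.innovDual T t i) = innovSeq (ξ.gammaW T)
      (fun t i => hY.sampleClass T (ξ.transformed T (obsDual T) t i)) t i :=
  map_innovSeq _ _ _ _ _

theorem gram_sampleClass_transformed (hY : ξ.IsVARMA P Y) (h : ξ.IsHilbertVARMA hY.obsClass e)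
    (hAR : ∀ z : ℂ, ‖z‖ ≤ 1 → (ξ.arPoly z).det ≠ 0) (hSym : ξ.SymmetricCovariance) (s t : ℕ)
    (hs : 1 ≤ s) (hst : s ≤ t) (ht : t ≤ T) :
    gram (fun i => hY.sampleClass T (ξ.transformed T (obsDual T) t i))
      (fun i => hY.sampleClass T (ξ.transformed T (obsDual T) s i)) = ξ.gammaW T t s := by
  rw [← h.gram_transformed hAR hSym hst]
  have h1 : ∀ s, 1 ≤ s → s ≤ T → (fun i => hY.sampleClass T (ξ.transformed T (obsDual T) s i)) =
      ξ.transformed T hY.obsClass s := fun s hs hs' => funext fun i =>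
    ξ.map_transformed _ _ _ hs hs' (fun u hu hu' j => hY.sampleClass_obsDual hu hu' j) i
  rw [h1 t (by omega) ht, h1 s hs (by omega)]

/-- The quadratic form at `v` is the squared norm of a nonzero functional of the sample.
Nonvanishing uses only det = 1 and independence of the observations, so there is no circularity with
the algorithm. -/
theorem posDef_gram_innovDual (hY : ξ.IsVARMA P Y) (h : ξ.IsHilbertVARMA hY.obsClass e)
    (hAR : ∀ z : ℂ, ‖z‖ ≤ 1 → (ξ.arPoly z).det ≠ 0) (hpos : ξ.covEps.PosDef) {t : ℕ}
    (ht : 1 ≤ t) (htT : t ≤ T) :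
    (gram (fun i => hY.sampleClass T (ξ.innovDual T t i))
      (fun i => hY.sampleClass T (ξ.innovDual T t i))).PosDef := by
  refine Matrix.PosDef.of_dotProduct_mulVec_pos ?_ fun v hv => ?_
  · rw [Matrix.IsHermitian, Matrix.conjTranspose_eq_transpose_of_trivial, gram_transpose]
  · have h1 : star v ⬝ᵥ (gram (fun i => hY.sampleClass T (ξ.innovDual T t i))
        (fun i => hY.sampleClass T (ξ.innovDual T t i))) *ᵥ v =
        ‖hY.sampleClass T (∑ i, v i • ξ.innovDual T t i)‖ ^ 2 := by
      rw [← real_inner_self_eq_norm_sq]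
      simp only [map_sum, map_smul, sum_inner, inner_sum, real_inner_smul_left,
        real_inner_smul_right, dotProduct, Matrix.mulVec, gram_apply, Finset.mul_sum,
        Pi.star_apply, star_trivial]
      rw [Finset.sum_comm]
      exact Finset.sum_congr rfl fun i _ => Finset.sum_congr rfl fun j _ => by ring
    rw [h1]
    have := hY.sampleClass_ne_zero h hAR hpos (ξ.sum_smul_innovDual_ne_zero ht htT hv)
    positivity

theorem gram_innovDual (hY : ξ.IsVARMA P Y) (h : ξ.IsHilbertVARMA hY.obsClass e)
    (hAR : ∀ z : ℂ, ‖z‖ ≤ 1 → (ξ.arPoly z).det ≠ 0) (hSym : ξ.SymmetricCovariance)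
    (hpos : ξ.covEps.PosDef) {s t : ℕ} (hs : s < T) (ht : t < T) :
    gram (fun i => hY.sampleClass T (ξ.innovDual T (t + 1) i))
      (fun i => hY.sampleClass T (ξ.innovDual T (s + 1) i)) =
      if t = s then ξ.sigmaW T (t + 1) else 0 := by
  have key := gram_innovSeq (K := ξ.gammaW T)
    (w := fun t i => hY.sampleClass T (ξ.transformed T (obsDual T) t i)) (T := T)
    (fun s t hs hst ht => hY.gram_sampleClass_transformed h hAR hSym s t hs hst ht)
    (fun t ht htT => by
      have := hY.posDef_gram_innovDual h hAR hpos ht htT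
      simpa only [sampleClass_innovDual] using this)
  simp only [sampleClass_innovDual]
  rcases lt_trichotomy t s with hts | hts | hts
  · rw [if_neg hts.ne, ← gram_transpose]
    exact (congrArg Matrix.transpose ((key s hs).2 t hts)).trans Matrix.transpose_zero
  · subst hts
    rw [if_pos rfl]
    exact (key t ht).1
  · rw [if_neg hts.ne']
    exact (key t ht).2 s hts

/-- Each W_{s+1} is its own innovation plus a combination of earlier ones, all orthogonal to a later
innovation. -/
theorem gram_innovDual_transformed (hY : ξ.IsVARMA P Y) (h : ξ.IsHilbertVARMA hY.obsClass e)
    (hAR : ∀ z : ℂ, ‖z‖ ≤ 1 → (ξ.arPoly z).det ≠ 0) (hSym : ξ.SymmetricCovariance)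
    (hpos : ξ.covEps.PosDef) {s t : ℕ} (hst : s < t) (ht : t < T) :
    gram (fun i => hY.sampleClass T (ξ.innovDual T (t + 1) i))
      (fun i => hY.sampleClass T (ξ.transformed T (obsDual T) (s + 1) i)) = 0 := by
  have h1 : (fun i => hY.sampleClass T (ξ.transformed T (obsDual T) (s + 1) i)) =
      (fun i => hY.sampleClass T (ξ.innovDual T (s + 1) i)) +
        ∑ k ∈ Finset.range s, innovCoef (ξ.gammaW T) s (s - k) •
          fun i => hY.sampleClass T (ξ.innovDual T (k + 1) i) := by
    rw [← sub_eq_iff_eq_add]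
    simp only [sampleClass_innovDual]
    exact (innovSeq_succ (ξ.gammaW T)
      (fun t i => hY.sampleClass T (ξ.transformed T (obsDual T) t i)) s).symm
  rw [h1, gram_add_right, gram_sum_right, hY.gram_innovDual h hAR hSym hpos (by omega) ht,
    if_neg hst.ne', zero_add]
  refine Finset.sum_eq_zero fun k hk => ?_
  have hk' : k < s := by simpa using hk
  rw [gram_smul_right, hY.gram_innovDual h hAR hSym hpos (by omega) ht, if_neg (by omega),
    zero_mul]

theorem posDef_sigmaW (hY : ξ.IsVARMA P Y) (h : ξ.IsHilbertVARMA hY.obsClass e)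
    (hAR : ∀ z : ℂ, ‖z‖ ≤ 1 → (ξ.arPoly z).det ≠ 0) (hSym : ξ.SymmetricCovariance)
    (hpos : ξ.covEps.PosDef) {t : ℕ} (ht : 1 ≤ t) (htT : t ≤ T) : (ξ.sigmaW T t).PosDef := by
  obtain ⟨t, rfl⟩ := Nat.exists_eq_add_of_le' ht
  have := hY.posDef_gram_innovDual h hAR hpos ht htT
  rwa [hY.gram_innovDual h hAR hSym hpos htT htT, if_pos rfl] at this

theorem map_sampleOf_eq_withDensity [IsProbabilityMeasure P] (hY : ξ.IsVARMA P Y)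
    (h : ξ.IsHilbertVARMA hY.obsClass e)
    (hsub : ((Submodule.span ℝ (Set.range fun k : ℤ × Fin n => e k.1 k.2)).topologicalClosure :
        Set (Lp ℝ 2 P)) ⊆ gaussianSet P)
    (hAR : ∀ z : ℂ, ‖z‖ ≤ 1 → (ξ.arPoly z).det ≠ 0) (hSym : ξ.SymmetricCovariance)
    (hpos : ξ.covEps.PosDef) (T : ℕ) :
    P.map (sampleOf T Y) = (volume : Measure (Fin T → Fin n → ℝ)).withDensity
      (fun y => ENNReal.ofReal (gZero y * ξ.gOne y)) := by
  have hsig : ∀ t, 1 ≤ t → t ≤ T → (ξ.sigmaW T t).PosDef := fun t ht htT =>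
    hY.posDef_sigmaW h hAR hSym hpos ht htT
  have hex : ∀ t, ∃ R : Matrix (Fin n) (Fin n) ℝ, 1 ≤ t → t ≤ T →
      Rᵀ * R = (ξ.sigmaW T t)⁻¹ := by
    intro t
    by_cases ht : 1 ≤ t ∧ t ≤ T
    · obtain ⟨R, hR⟩ := (hsig t ht.1 ht.2).exists_transpose_mul_self_eq_inv
      exact ⟨R, fun _ _ => hR⟩
    · exact ⟨0, fun h1 h2 => absurd ⟨h1, h2⟩ ht⟩
  choose R hR using hex
  have habs := ξ.abs_det_whitenMap hsig hR
  have hdet : LinearMap.det (ξ.whitenMap T R) ≠ 0 := by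
    rw [← abs_pos, habs]
    refine Real.rpow_pos_of_pos (Finset.prod_pos fun t ht => ?_) _
    rw [Finset.mem_Icc] at ht
    exact (hsig t ht.1 ht.2).det_pos
  have hlaw := hY.map_eq_pi_gaussianReal (hY.integral_exp_dual h hsub hAR) (ξ.whitenMap T R)
    fun k m => by
      have h1 : ∀ k : Fin T, (fun i => hY.sampleClass T
          ((LinearMap.proj i : (Fin n → ℝ) →ₗ[ℝ] ℝ) ∘ₗ
          (LinearMap.proj k : (Fin T → Fin n → ℝ) →ₗ[ℝ] Fin n → ℝ) ∘ₗ ξ.whitenMap T R)) =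
          R (k + 1) • fun i => hY.sampleClass T (ξ.innovDual T (k + 1) i) := by
        intro k
        funext i
        rw [Matrix.Module.smul_apply]
        simp only [← map_smul, ← map_sum]
        congr 1
        refine LinearMap.ext fun y => ?_
        simp only [LinearMap.comp_apply, LinearMap.proj_apply, whitenMap_apply,
          LinearMap.sum_apply, LinearMap.smul_apply, Matrix.mulVec, dotProduct, smul_eq_mul]
        refine Finset.sum_congr rfl fun j _ => ?_
        rw [innovDual_apply _ _ (by omega)]
      rw [h1 k, h1 m, gram_smul_left, gram_smul_right,
        hY.gram_innovDual h hAR hSym hpos m.2 k.2]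
      by_cases hkm : k = m
      · subst hkm
        -- R Σ Rᵀ = 1 is equivalent to Σ Rᵀ R = 1, which is the choice of `R`.
        rw [if_pos rfl, if_pos rfl, mul_eq_one_comm, Matrix.mul_assoc, hR _ (by omega) (by omega)]
        exact Matrix.mul_nonsing_inv _ (hsig _ (by omega) (by omega)).det_pos.ne'.isUnit
      · rw [if_neg hkm, if_neg (fun h => hkm (Fin.ext h)), zero_mul, mul_zero]
  rw [pi_pi_gaussianReal_eq_withDensity] at hlaw
  rw [map_eq_withDensity_of_linearMap (hY.measurable_sampleOf T) hdet hlaw]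
  congr 1
  funext y
  rw [← ENNReal.ofReal_mul (abs_nonneg _), prod_prod_gaussianPDFReal, habs, gOne,
    ξ.quadForm_eq hR]
  congr 1
  rw [gZero, gZero]
  ring

theorem condExp_forwardW [IsProbabilityMeasure P] (hY : ξ.IsVARMA P Y)
    (h : ξ.IsHilbertVARMA hY.obsClass e)
    (hsub : ((Submodule.span ℝ (Set.range fun k : ℤ × Fin n => e k.1 k.2)).topologicalClosure :
        Set (Lp ℝ 2 P)) ⊆ gaussianSet P)
    (hAR : ∀ z : ℂ, ‖z‖ ≤ 1 → (ξ.arPoly z).det ≠ 0) (hSym : ξ.SymmetricCovariance)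
    (hpos : ξ.covEps.PosDef) {t : ℕ} (ht : 1 ≤ t) (htT : t ≤ T) :
    P[fun ω => ξ.forwardW (sampleOf T Y ω) t |
        MeasurableSpace.comap
          (fun ω (s : Finset.Ico 1 t) => ξ.forwardW (sampleOf T Y ω) (s : ℕ)) inferInstance]
        =ᵐ[P] fun ω => ξ.predW (sampleOf T Y ω) t := by
  set V : Ω → Finset.Ico 1 t → Fin n → ℝ :=
    fun ω (s : Finset.Ico 1 t) => ξ.forwardW (sampleOf T Y ω) (s : ℕ) with hV
  have hS := hY.measurable_sampleOf T
  have hVm : Measurable V := measurable_pi_lambda _ fun s =>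
    (ξ.measurable_forwardW _).comp hS
  have hIm : Measurable fun ω => ξ.innovW (sampleOf T Y ω) t := (ξ.measurable_innovW ht).comp hS
  have hle : MeasurableSpace.comap V inferInstance ≤ ‹MeasurableSpace Ω› := hVm.comap_le
  have hind : (fun ω => ξ.innovW (sampleOf T Y ω) t) ⟂ᵢ[P] V := by
    have h1 := hY.indepFun_of_inner_eq_zero (hY.integral_exp_dual h hsub hAR)
      (LinearMap.pi fun i => ξ.innovDual T t i)
      (LinearMap.pi fun s : Finset.Ico 1 t => LinearMap.pi fun i =>
        ξ.transformed T (obsDual T) (s : ℕ) i) fun i k j => by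
        obtain ⟨t, rfl⟩ := Nat.exists_eq_add_of_le' ht
        obtain ⟨s, hs⟩ := k
        rw [Finset.mem_Ico] at hs
        obtain ⟨s, rfl⟩ := Nat.exists_eq_add_of_le' hs.1
        exact congrFun (congrFun (hY.gram_innovDual_transformed h hAR hSym hpos
          (s := s) (t := t) (by omega) (by omega)) i) j
    have e1 : (fun ω => (LinearMap.pi fun i => ξ.innovDual T t i) (sampleOf T Y ω)) =
        fun ω => ξ.innovW (sampleOf T Y ω) t := by
      funext ω i
      exact ξ.innovDual_apply _ ht i
    have e2 : (fun ω => (LinearMap.pi fun s : Finset.Ico 1 t => LinearMap.pi fun i =>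
        ξ.transformed T (obsDual T) (s : ℕ) i) (sampleOf T Y ω)) = V := by
      funext ω s i
      exact ξ.transformed_obsDual_apply _ _ i
    rwa [e1, e2] at h1
  have hF : ∀ s, 1 ≤ s → s < t → Measurable[MeasurableSpace.comap V inferInstance]
      fun ω => ξ.forwardW (sampleOf T Y ω) s := fun s hs hst =>
    (measurable_pi_apply (⟨s, Finset.mem_Ico.2 ⟨hs, hst⟩⟩ : Finset.Ico 1 t)).comp
      (comap_measurable V)
  -- Past innovations are functions of the past W alone, which makes the predictor measurable for
  -- the conditioning σ-algebra.
  have hI : ∀ s, s + 1 < t → Measurable[MeasurableSpace.comap V inferInstance]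
      fun ω => ξ.innovW (sampleOf T Y ω) (s + 1) := by
    intro s
    induction s using Nat.strong_induction_on with
    | _ s ih =>
      intro hs
      rw [show (fun ω => ξ.innovW (sampleOf T Y ω) (s + 1)) = _ from
        funext fun ω => ξ.innovW_succ _ s]
      refine (hF _ (by omega) hs).sub (Finset.measurable_fun_sum _ fun k hk => ?_)
      have hk' : k < s := by simpa using hk
      exact (Matrix.measurable_mulVec _).comp
        (ih k hk' (by omega))
  have hpred : ∀ y : Fin T → Fin n → ℝ, ξ.predW y t = ξ.forwardW y t - ξ.innovW y t := by
    intro y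
    rw [innovW, sub_sub_cancel]
  have hP : Measurable[MeasurableSpace.comap V inferInstance]
      fun ω => ξ.predW (sampleOf T Y ω) t := by
    obtain ⟨t, rfl⟩ := Nat.exists_eq_add_of_le' ht
    rw [show (fun ω => ξ.predW (sampleOf T Y ω) (t + 1)) = fun ω => ∑ k ∈ Finset.range t,
      innovCoef (ξ.gammaW T) t (t - k) *ᵥ ξ.innovW (sampleOf T Y ω) (k + 1) from
      funext fun ω => by rw [hpred, innovW_succ, sub_sub_cancel]]
    refine Finset.measurable_fun_sum _ fun k hk => ?_
    have hk' : k < t := by simpa using hk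
    exact (Matrix.measurable_mulVec _).comp
      (hI k (by omega))
  have hIint : Integrable (fun ω => ξ.innovW (sampleOf T Y ω) t) P := by
    refine Integrable.of_eval fun i => ?_
    simp only [← ξ.innovDual_apply _ ht]
    exact (hY.memLp_dual _).integrable (by norm_num)
  have hFint : Integrable (fun ω => ξ.forwardW (sampleOf T Y ω) t) P := by
    refine Integrable.of_eval fun i => ?_
    simp only [← transformed_obsDual_apply]
    exact (hY.memLp_dual _).integrable (by norm_num)
  have hPint : Integrable (fun ω => ξ.predW (sampleOf T Y ω) t) P := by
    simp only [hpred]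
    exact hFint.sub hIint
  have hI0 : ∫ ω, ξ.innovW (sampleOf T Y ω) t ∂P = 0 := by
    funext i
    rw [eval_integral fun i => Integrable.eval hIint i]
    simp only [← ξ.innovDual_apply _ ht]
    exact hY.integral_dual _
  have hsum : (fun ω => ξ.forwardW (sampleOf T Y ω) t) =
      (fun ω => ξ.predW (sampleOf T Y ω) t) + fun ω => ξ.innovW (sampleOf T Y ω) t := by
    funext ω
    rw [Pi.add_apply, innovW, add_sub_cancel]
  have c1 := condExp_add hPint hIint (MeasurableSpace.comap V inferInstance)
  have c2 : P[fun ω => ξ.predW (sampleOf T Y ω) t | MeasurableSpace.comap V inferInstance] =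
      fun ω => ξ.predW (sampleOf T Y ω) t :=
    condExp_of_stronglyMeasurable hle hP.stronglyMeasurable hPint
  -- The current innovation is independent of the past, so conditioning leaves only its mean, which
  -- is zero.
  have c3 := condExp_indep_eq hIm.comap_le hle
    (comap_measurable fun ω => ξ.innovW (sampleOf T Y ω) t).stronglyMeasurable hind
  rw [hsum]
  filter_upwards [c1, c3] with ω h1 h3
  rw [h1, Pi.add_apply, h3, c2, hI0, add_zero]

end IsVARMA

end VARMAParam

end

theorem theorem2 {Ω : Type*} [MeasurableSpace Ω] (P : Measure Ω) [IsProbabilityMeasure P]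
    {n p q : ℕ} (T : ℕ) (ξ : VARMAParam n p q)
    (hpos : ξ.covEps.PosDef)
    (hCI : ξ.CausalInvertible)
    (hSym : ξ.SymmetricCovariance)
    (Y : ℤ → Ω → Fin n → ℝ) (hY : ξ.IsVARMA P Y) :
    -- the joint law of the sample has Lebesgue density `g₀(Y) g₁(Y, ξ)`
    P.map (sampleOf T Y) =
      (volume : Measure (Fin T → Fin n → ℝ)).withDensity
        (fun y => ENNReal.ofReal (gZero y * ξ.gOne y)) ∧
    -- `Γ_Y` is the autocovariance of `Y`
    (∀ (t h : ℤ) (i j : Fin n),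
      cov[fun ω => Y t ω i, fun ω => Y (t - h) ω j; P] = ξ.gammaY h i j) ∧
    -- `Γ_W` is the covariance of the forward transformation
    (∀ s t : ℕ, 1 ≤ s → s ≤ t → t ≤ T → ∀ i j : Fin n,
      cov[fun ω => ξ.forwardW (sampleOf T Y ω) t i,
        fun ω => ξ.forwardW (sampleOf T Y ω) s j; P] = ξ.gammaW T t s i j) ∧
    -- `Ŵ_t` is the one-step predictor of `W_t`, with prediction error covariance `Σ_t`
    (∀ t : ℕ, 1 ≤ t → t ≤ T →
      (P[fun ω => ξ.forwardW (sampleOf T Y ω) t |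
        MeasurableSpace.comap
          (fun ω (s : Finset.Ico 1 t) => ξ.forwardW (sampleOf T Y ω) (s : ℕ)) inferInstance]
        =ᵐ[P] fun ω => ξ.predW (sampleOf T Y ω) t) ∧
      (∀ i j : Fin n,
        cov[fun ω => ξ.innovW (sampleOf T Y ω) t i,
          fun ω => ξ.innovW (sampleOf T Y ω) t j; P] = ξ.sigmaW T t i j) ∧
      (ξ.sigmaW T t).PosDef) := by
  have hAR : ∀ z : ℂ, ‖z‖ ≤ 1 → (ξ.arPoly z).det ≠ 0 := fun z hz => (hCI z hz).1
  obtain ⟨e, h, hsub⟩ := hY.exists_isHilbertVARMA hpos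
  refine ⟨hY.map_sampleOf_eq_withDensity h hsub hAR hSym hpos T, fun t k i j => ?_,
    fun s t hs hst ht i j => ?_, fun t ht htT => ⟨hY.condExp_forwardW h hsub hAR hSym hpos ht htT,
    fun i j => ?_, hY.posDef_sigmaW h hAR hSym hpos ht htT⟩⟩
  · rw [← hY.gram_obsClass, h.gram_eq_gammaY hAR]
  · rw [← hY.gram_sampleClass_transformed h hAR hSym s t hs hst ht, gram_apply,
      hY.inner_sampleClass]
    simp only [VARMAParam.transformed_obsDual_apply]
  · obtain ⟨t, rfl⟩ := Nat.exists_eq_add_of_le' ht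
    have h1 := hY.gram_innovDual h hAR hSym hpos (T := T) (s := t) (t := t) htT htT
    rw [if_pos rfl] at h1
    rw [← h1, gram_apply, hY.inner_sampleClass]
    simp only [ξ.innovDual_apply _ ht]
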